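/- Throughout, links are oriented links in $S^3$ up to ambient isotopy, that is, oriented link diagrams in the plane up to planar isotopy and Reidemeister moves. An $S_3$-coloring of a diagram $D$ is a map $\Gamma$ from the set of arcs of $D$ to $S_3\setminus\{e\}$, where $S_3$ is the symmetric group of degree three and $e$ its identity element, such that at each crossing $\Gamma(x)\Gamma(y)=\Gamma(z)\Gamma(x)$ if the crossing is positive, and $\Gamma(x)\Gamma(z)=\Gamma(y)\Gamma(x)$ if it is negative; here $x$ is the over arc, and $y$ and $z$ are the under arcs before and after passing through the crossing, respectively. An $(S_3,n)$-coloring is an $S_3$-coloring whose image has exactly $n$ elements, and a link is $(S_3,n)$-colorable if at least one of its diagrams admits an $(S_3,n)$-coloring. A 2-bridge link is a link whose bridge number (the least number of local maxima of the height function among all diagrams of the link) is $2$. **Theorem.** Every $(S_3,5)$-colorable 2-bridge link is $(S_3,4)$-colorable. -/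

import Mathlib

/-!
Oriented link diagrams in the plane, links, bridge number, and colorings by `S₃`.

A diagram in the plane that is generic with respect to the height function is cut by horizontal
lines into layers, each of which contains exactly one local minimum, one local maximum or one
crossing and is made of vertical strands elsewhere.  Such a diagram is recorded by the word of its
layers, read from bottom to top.  Every oriented link diagram is planar isotopic to one of this
form.  A link is an equivalence class of diagrams under planar isotopy and Reidemeister moves.
-/

namespace S3Link

/-- What a layer contains besides vertical strands.  Directions of strands are recorded by
Booleans: `true` is upward, `false` is downward.

* `cup o`: a local minimum, whose left branch has direction `o` and whose right branch has
  the opposite direction.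
* `cap`: a local maximum.
* `cross b`: a crossing of two neighboring strands; the strand that runs from bottom left to top
  right is the over strand if `b = true`, and the under strand if `b = false`. -/
inductive Kind where
  | cup (o : Bool) : Kind
  | cap : Kind
  | cross (b : Bool) : Kind

/-- The number of end points that a piece has on the lower line of its layer. -/
def Kind.inputs : Kind → ℕ
  | .cup _ => 0
  | .cap => 2
  | .cross _ => 2

/-- The number of end points that a piece has on the upper line of its layer. -/
def Kind.outputs : Kind → ℕ
  | .cup _ => 2
  | .cap => 0
  | .cross _ => 2

/-- A layer: a minimum, a maximum or a crossing, with exactly `pos` vertical strands to its left. -/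
structure Layer where
  kind : Kind
  pos : ℕ

/-- If the directions of the strands at the lower line are `s`, listed from left to right, then
`P.step s` lists the directions at the upper line; it is `none` if the layer `P` does not fit
on top of `s`, because there are too few strands or because a maximum would join
two strands whose directions do not match. -/
def Layer.step : Layer → List Bool → Option (List Bool)
  | ⟨.cup o, a⟩, s => if a ≤ s.length then some (s.take a ++ o :: (!o) :: s.drop a) else none
  | ⟨.cap, a⟩, s =>
      match s.drop a with
      | d :: e :: r => if e = !d then some (s.take a ++ r) else none
      | _ => none
  | ⟨.cross _, a⟩, s =>
      match s.drop a with
      | d :: e :: r => some (s.take a ++ e :: d :: r)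
      | _ => none

/-- The directions at the top of a word of layers that is put on top of `s`. -/
def run : List Layer → List Bool → Option (List Bool)
  | [], s => some s
  | P :: w, s => (P.step s).bind (run w)

/-- An oriented link diagram: a word of layers which fit on top of each other,
without end points at the bottom and at the top. -/
structure Diagram where
  word : List Layer
  closed : run word [] = some []

/-- The local moves on words of layers.  The constructors `exchange`, `zigzagLeft`, `zigzagRight`,
`slideCup`, `slideCap` are planar isotopies, the others are the Reidemeister moves. -/
inductive LocalMove : List Layer → List Layer → Prop where
  /-- Change of the relative height of two pieces that lie side by side. -/
  | exchange (c d : Kind) (a n : ℕ) :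
      LocalMove [⟨c, a + d.inputs + n⟩, ⟨d, a⟩] [⟨d, a⟩, ⟨c, a + d.outputs + n⟩]
  /-- Cancellation of a minimum with the maximum on its left. -/
  | zigzagLeft (o : Bool) (a : ℕ) : LocalMove [⟨.cup o, a + 1⟩, ⟨.cap, a⟩] []
  /-- Cancellation of a minimum with the maximum on its right. -/
  | zigzagRight (o : Bool) (a : ℕ) : LocalMove [⟨.cup o, a⟩, ⟨.cap, a + 1⟩] []
  /-- A strand that crosses the right branch of a minimum is moved to its left branch. -/
  | slideCup (o b : Bool) (a : ℕ) :
      LocalMove [⟨.cup o, a⟩, ⟨.cross b, a + 1⟩] [⟨.cup o, a + 1⟩, ⟨.cross (!b), a⟩]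
  /-- A strand that crosses the right branch of a maximum is moved to its left branch. -/
  | slideCap (b : Bool) (a : ℕ) :
      LocalMove [⟨.cross b, a + 1⟩, ⟨.cap, a⟩] [⟨.cross (!b), a⟩, ⟨.cap, a + 1⟩]
  /-- Reidemeister move I, at a minimum. -/
  | reidemeisterOneCup (o b : Bool) (a : ℕ) :
      LocalMove [⟨.cup o, a⟩, ⟨.cross b, a⟩] [⟨.cup (!o), a⟩]
  /-- Reidemeister move I, at a maximum. -/
  | reidemeisterOneCap (b : Bool) (a : ℕ) :
      LocalMove [⟨.cross b, a⟩, ⟨.cap, a⟩] [⟨.cap, a⟩]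
  /-- Reidemeister move II. -/
  | reidemeisterTwo (b : Bool) (a : ℕ) :
      LocalMove [⟨.cross b, a⟩, ⟨.cross (!b), a⟩] []
  /-- Reidemeister move III.  For the three strands `A`, `B`, `C`, counted from the left
  at the bottom, `b₁`, `b₂`, `b₃` say whether `A` is over `B`, `A` over `C`, `B` over `C`;
  the hypothesis says that this relation is not cyclic. -/
  | reidemeisterThree (b₁ b₂ b₃ : Bool) (h : b₁ = b₂ ∨ b₂ = b₃) (a : ℕ) :
      LocalMove [⟨.cross b₁, a⟩, ⟨.cross b₂, a + 1⟩, ⟨.cross b₃, a⟩]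
        [⟨.cross b₃, a + 1⟩, ⟨.cross b₂, a⟩, ⟨.cross b₁, a + 1⟩]

/-- `D'` arises from `D` by one local move. -/
def Diagram.Move (D D' : Diagram) : Prop :=
  ∃ u l r v : List Layer, LocalMove l r ∧ D.word = u ++ l ++ v ∧ D'.word = u ++ r ++ v

/-- Oriented links: diagrams modulo the equivalence relation generated by the moves. -/
def Link : Type := Quot Diagram.Move

/-- `D` is a diagram of the link `L`. -/
def Diagram.IsDiagramOf (D : Diagram) (L : Link) : Prop := Quot.mk Diagram.Move D = L

/-- The number of local maxima of a diagram. -/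
def Diagram.maxima (D : Diagram) : ℕ :=
  D.word.countP fun P => match P.kind with
    | .cap => true
    | _ => false

/-- The bridge number: the least number of local maxima of a diagram of the link. -/
noncomputable def Link.bridgeNumber (L : Link) : ℕ :=
  sInf {n | ∃ D : Diagram, D.IsDiagramOf L ∧ D.maxima = n}

def Link.IsTwoBridge (L : Link) : Prop := L.bridgeNumber = 2

/-- The directions of the strands at the `k`-th horizontal line, which is the lower line of the
layer `D.word[k]`. -/
def Diagram.level (D : Diagram) (k : ℕ) : List Bool := (run (D.word.take k) []).getD []

/-- The intersection points of the diagram with the horizontal lines; `(k, j)` is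
the point on the `k`-th line that has `j` points to its left. -/
def Diagram.Point (D : Diagram) : Type := {p : ℕ × ℕ // p.2 < (D.level p.1).length}

/-- The direction of the strand through a point. -/
def Diagram.direction (D : Diagram) (p : D.Point) : Bool := (D.level p.1.1)[p.1.2]'p.2

/-- `P.Joins k p q`: if `P` is the layer between the lines `k` and `k + 1`, then the points `p` and
`q` are the two ends of a strand in that layer that is not the under strand of a crossing. -/
inductive Layer.Joins (k : ℕ) : Layer → ℕ × ℕ → ℕ × ℕ → Prop where
  | left (c : Kind) (a j : ℕ) (h : j < a) : Joins k ⟨c, a⟩ (k, j) (k + 1, j)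
  | right (c : Kind) (a j : ℕ) :
      Joins k ⟨c, a⟩ (k, a + c.inputs + j) (k + 1, a + c.outputs + j)
  | cup (o : Bool) (a : ℕ) : Joins k ⟨.cup o, a⟩ (k + 1, a) (k + 1, a + 1)
  | cap (a : ℕ) : Joins k ⟨.cap, a⟩ (k, a) (k, a + 1)
  | overRising (a : ℕ) : Joins k ⟨.cross true, a⟩ (k, a) (k + 1, a + 1)
  | overFalling (a : ℕ) : Joins k ⟨.cross false, a⟩ (k, a + 1) (k + 1, a)

def Diagram.Joined (D : Diagram) (p q : D.Point) : Prop :=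
  ∃ (k : ℕ) (P : Layer), D.word[k]? = some P ∧ P.Joins k p.1 q.1

/-- The arcs of a diagram: its parts that run from undercrossing to undercrossing (or are closed
curves without undercrossing). -/
def Diagram.Arc (D : Diagram) : Type := Quot D.Joined

def Diagram.arc (D : Diagram) (p : D.Point) : D.Arc := Quot.mk D.Joined p

/-- `D.IsCrossing s x y z`: at some crossing of `D`, which is positive if `s = true` and negative if
`s = false`, the over arc is `x`, and the under arcs are `y` before and `z` after passing the
crossing, with respect to the orientation.  Here `p`, `u` are the lower ends of
the over and the under strand, and `t` is the upper end of the under strand. -/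
def Diagram.IsCrossing (D : Diagram) (s : Bool) (x y z : D.Arc) : Prop :=
  ∃ (k a : ℕ) (b : Bool) (p u t : D.Point),
    D.word[k]? = some ⟨.cross b, a⟩ ∧
    p.1 = (k, if b then a else a + 1) ∧
    u.1 = (k, if b then a + 1 else a) ∧
    t.1 = (k + 1, if b then a else a + 1) ∧
    s = (b == (D.direction p == D.direction u)) ∧
    x = D.arc p ∧
    y = D.arc (if D.direction u then u else t) ∧
    z = D.arc (if D.direction u then t else u)

/-- The symmetric group of degree three. -/
abbrev S3 : Type := Equiv.Perm (Fin 3)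

/-- The condition on a map from the arcs to `S₃ ∖ {e}` to be an `S₃`-coloring. -/
def Diagram.IsColoring (D : Diagram) (Γ : D.Arc → {g : S3 // g ≠ 1}) : Prop :=
  (∀ x y z : D.Arc, D.IsCrossing true x y z →
    (Γ x : S3) * (Γ y : S3) = (Γ z : S3) * (Γ x : S3)) ∧
  (∀ x y z : D.Arc, D.IsCrossing false x y z →
    (Γ x : S3) * (Γ z : S3) = (Γ y : S3) * (Γ x : S3))

/-- The diagram admits an `(S₃, n)`-coloring: an `S₃`-coloring with exactly `n` colors. -/
def Diagram.HasColoring (D : Diagram) (n : ℕ) : Prop :=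
  ∃ Γ : D.Arc → {g : S3 // g ≠ 1}, D.IsColoring Γ ∧ (Set.range Γ).ncard = n

/-- `(S₃, n)`-colorability of a link. -/
def Link.IsColorable (L : Link) (n : ℕ) : Prop :=
  ∃ D : Diagram, D.IsDiagramOf L ∧ D.HasColoring n

end S3Link

/-!
Every color of an `S₃`-coloring is made into a *signed* color: the color itself on an upward strand,
its inverse on a downward one. In signed colors the rule at a crossing no longer mentions
directions: the over strand conjugates the under strand (`crossing_condition_iff`), and the two ends
of a minimum or maximum carry inverse elements. So a coloring amounts to a consistent choice of a
list of signed colors on every horizontal line (`IsLeveling`), and colorings can be followed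
through the moves together with the set of signs of their colors as permutations (`Col`,
`Diagram.col_iff_of_link_eq`). A coloring by all five nontrivial elements shows both signs, so
each diagram of the link has a coloring that uses both 3-cycles and transpositions.

A diagram with two maxima is isotopic to a plat closure: two minima, a braid on four strands, two
maxima (`Diagram.exists_plat`). Above the two minima, the generators act on isotopy classes of
tangles, and there `σ 0` and `σ 2` act in the same way and a full twist `(σ 0 σ 1)³` acts trivially
(`Tangle.σ_two_eq`, `Tangle.σ_fullTwist`). Hence what remains is an action of the modular group,
in which `σ 0 ²` and `σ 1 ²` generate a subgroup with six cosets. Up to isotopy the braid is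
therefore a product of squares of `σ 0` and `σ 1`, followed by one of six short words
(`Tangle.exists_normalForm`). Squares do not move the signs of the colors. As both signs occur, the
signs that arrive at the maxima exclude all short words but the trivial one and a half twist of the
left pair (`eq_of_mem_cosetWords`), and the half twist is undone at the left maximum by a
Reidemeister move of type one.

Now one pair of strands is colored by a 3-cycle and the other one by a transposition. Since
`σ 0` and `σ 2` act in the same way, all squares outside of the middle may be taken on the pair that
carries the 3-cycle. There they do not change any color, and a square in the middle alternates
between two lists of signed colors. So only four colors occur at all, namely the two 3-cycles and
two transpositions (`exists_leveling_twists`). Finally `σ 1 ² σ 1 ⁻²` is put in front of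
the braid, which does not change the link and makes all four of them occur (`hasColoring_four`).
-/

namespace S3Link

/-! ### Words of layers and their boundary directions -/

theorem step_succ_cons (c : Kind) (a : ℕ) (x : Bool) (s : List Bool) :
    Layer.step ⟨c, a + 1⟩ (x :: s) = (Layer.step ⟨c, a⟩ s).map (x :: ·) := by
  cases c with
  | cup o => simp only [Layer.step, List.length_cons, Nat.add_le_add_iff_right]; split_ifs <;> simp
  | cap =>
    simp only [Layer.step, List.drop_succ_cons]
    split
    · split_ifs <;> simp_all
    · simp_all
  | cross b =>
    simp only [Layer.step, List.drop_succ_cons]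
    split <;> simp_all

theorem step_succ_nil (c : Kind) (a : ℕ) : Layer.step ⟨c, a + 1⟩ [] = none := by
  cases c <;> simp [Layer.step]

@[simp] theorem step_cup_zero (o : Bool) (s : List Bool) :
    Layer.step ⟨.cup o, 0⟩ s = some (o :: (!o) :: s) := by simp [Layer.step]

@[simp] theorem step_cap_zero_nil : Layer.step ⟨.cap, 0⟩ [] = none := by simp [Layer.step]

@[simp] theorem step_cap_zero_singleton (x : Bool) : Layer.step ⟨.cap, 0⟩ [x] = none := by
  simp [Layer.step]

@[simp] theorem step_cap_zero (x y : Bool) (s : List Bool) :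
    Layer.step ⟨.cap, 0⟩ (x :: y :: s) = if y = !x then some s else none := by
  simp [Layer.step]

@[simp] theorem step_cross_zero_nil (b : Bool) : Layer.step ⟨.cross b, 0⟩ [] = none := by
  simp [Layer.step]

@[simp] theorem step_cross_zero_singleton (b x : Bool) : Layer.step ⟨.cross b, 0⟩ [x] = none := by
  simp [Layer.step]

@[simp] theorem step_cross_zero (b x y : Bool) (s : List Bool) :
    Layer.step ⟨.cross b, 0⟩ (x :: y :: s) = some (y :: x :: s) := by
  simp [Layer.step]

@[simp] theorem run_nil (s : List Bool) : run [] s = some s := rfl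

@[simp] theorem run_cons (P : Layer) (w : List Layer) (s : List Bool) :
    run (P :: w) s = (P.step s).bind (run w) := rfl

theorem run_append (u v : List Layer) (s : List Bool) :
    run (u ++ v) s = (run u s).bind (run v) := by
  induction u generalizing s with
  | nil => simp
  | cons P u ih => cases h : P.step s <;> simp [h, ih]

/-- The layer with `n` more strands on its left. -/
def Layer.shift (n : ℕ) (P : Layer) : Layer := ⟨P.kind, n + P.pos⟩

@[simp] theorem Layer.shift_mk (n : ℕ) (c : Kind) (a : ℕ) :
    Layer.shift n ⟨c, a⟩ = ⟨c, n + a⟩ := rfl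

theorem Layer.shift_zero (w : List Layer) : w.map (Layer.shift 0) = w := by
  have : Layer.shift 0 = id := by funext P; cases P; simp [Layer.shift]
  simp [this]

theorem run_shift_one (w : List Layer) (x : Bool) (s : List Bool) :
    run (w.map (Layer.shift 1)) (x :: s) = (run w s).map (x :: ·) := by
  induction w generalizing s with
  | nil => simp
  | cons P w ih =>
    obtain ⟨c, a⟩ := P
    simp only [List.map_cons, Layer.shift_mk, run_cons, Nat.add_comm 1 a, step_succ_cons]
    cases h : Layer.step ⟨c, a⟩ s <;> simp [ih]

theorem map_shift_succ (n : ℕ) (w : List Layer) :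
    w.map (Layer.shift (n + 1)) = (w.map (Layer.shift n)).map (Layer.shift 1) := by
  simp only [List.map_map]
  congr 1
  funext P
  simp only [Layer.shift, Function.comp, Layer.mk.injEq, true_and]
  omega

theorem run_shift_congr {l r : List Layer} (hl : l ≠ []) (hr : r ≠ [])
    (h : ∀ s, run l s = run r s) (n : ℕ) (s : List Bool) :
    run (l.map (Layer.shift n)) s = run (r.map (Layer.shift n)) s := by
  induction n generalizing s with
  | zero => simpa [Layer.shift_zero] using h s
  | succ n ih =>
    rw [map_shift_succ n l, map_shift_succ n r]
    cases s with
    | nil =>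
      obtain ⟨P, l, rfl⟩ := List.exists_cons_of_ne_nil hl
      obtain ⟨P', r, rfl⟩ := List.exists_cons_of_ne_nil hr
      simp [Layer.shift, Nat.add_comm 1, step_succ_nil]
    | cons x s => rw [run_shift_one, run_shift_one, ih]

theorem run_exchange (c d : Kind) (a n : ℕ) (s : List Bool) :
    run [⟨c, a + d.inputs + n⟩, ⟨d, a⟩] s = run [⟨d, a⟩, ⟨c, a + d.outputs + n⟩] s := by
  have h0 : ∀ s, run [⟨c, d.inputs + n⟩, ⟨d, 0⟩] s = run [⟨d, 0⟩, ⟨c, d.outputs + n⟩] s := by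
    intro s
    cases d with
    | cup o =>
      simp only [Kind.inputs, Kind.outputs, run_cons, Nat.zero_add, step_cup_zero,
        Nat.add_comm 2 n, step_succ_cons, Option.bind_some]
      cases h : Layer.step ⟨c, n⟩ s <;> simp
    | cap =>
      simp only [Kind.inputs, Kind.outputs, run_cons, Nat.zero_add, Nat.add_comm 2 n]
      rcases s with _ | ⟨x, _ | ⟨y, s⟩⟩
      · simp [step_succ_nil]
      · simp [step_succ_cons, step_succ_nil]
      · by_cases e : y = !x <;> cases h : Layer.step ⟨c, n⟩ s <;> simp [step_succ_cons, e, h]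
    | cross b =>
      simp only [Kind.inputs, Kind.outputs, run_cons, Nat.add_comm 2 n]
      rcases s with _ | ⟨x, _ | ⟨y, s⟩⟩
      · simp [step_succ_nil]
      · simp [step_succ_cons, step_succ_nil]
      · cases h : Layer.step ⟨c, n⟩ s <;> simp [step_succ_cons, h]
  simpa [Nat.add_assoc] using run_shift_congr (by simp) (by simp) h0 a s

theorem run_slideCup (o b : Bool) (a : ℕ) (s : List Bool) :
    run [⟨.cup o, a⟩, ⟨.cross b, a + 1⟩] s = run [⟨.cup o, a + 1⟩, ⟨.cross (!b), a⟩] s := by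
  have h0 : ∀ s, run [⟨.cup o, 0⟩, ⟨.cross b, 1⟩] s = run [⟨.cup o, 1⟩, ⟨.cross (!b), 0⟩] s := by
    rintro (_ | ⟨x, s⟩) <;> simp [step_succ_cons, step_succ_nil]
  simpa using run_shift_congr (by simp) (by simp) h0 a s

theorem run_slideCap (b : Bool) (a : ℕ) (s : List Bool) :
    run [⟨.cross b, a + 1⟩, ⟨.cap, a⟩] s = run [⟨.cross (!b), a⟩, ⟨.cap, a + 1⟩] s := by
  have h0 : ∀ s, run [⟨.cross b, 1⟩, ⟨.cap, 0⟩] s = run [⟨.cross (!b), 0⟩, ⟨.cap, 1⟩] s := by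
    rintro (_ | ⟨x, _ | ⟨y, _ | ⟨z, s⟩⟩⟩) <;>
      simp [step_succ_cons, step_succ_nil]
  simpa using run_shift_congr (by simp) (by simp) h0 a s

theorem run_reidemeisterOneCup (o b : Bool) (a : ℕ) (s : List Bool) :
    run [⟨.cup o, a⟩, ⟨.cross b, a⟩] s = run [⟨.cup (!o), a⟩] s := by
  have h0 : ∀ s, run [⟨.cup o, 0⟩, ⟨.cross b, 0⟩] s = run [⟨.cup (!o), 0⟩] s := by
    intro s; simp
  simpa using run_shift_congr (by simp) (by simp) h0 a s

theorem run_reidemeisterOneCap (b : Bool) (a : ℕ) (s : List Bool) :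
    run [⟨.cross b, a⟩, ⟨.cap, a⟩] s = run [⟨.cap, a⟩] s := by
  have h0 : ∀ s, run [⟨.cross b, 0⟩, ⟨.cap, 0⟩] s = run [⟨.cap, 0⟩] s := by
    rintro (_ | ⟨x, _ | ⟨y, s⟩⟩) <;> simp
    cases x <;> cases y <;> simp
  simpa using run_shift_congr (by simp) (by simp) h0 a s

theorem run_reidemeisterThree (b₁ b₂ b₃ : Bool) (a : ℕ) (s : List Bool) :
    run [⟨.cross b₁, a⟩, ⟨.cross b₂, a + 1⟩, ⟨.cross b₃, a⟩] s =
      run [⟨.cross b₃, a + 1⟩, ⟨.cross b₂, a⟩, ⟨.cross b₁, a + 1⟩] s := by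
  have h0 : ∀ s, run [⟨.cross b₁, 0⟩, ⟨.cross b₂, 1⟩, ⟨.cross b₃, 0⟩] s =
      run [⟨.cross b₃, 1⟩, ⟨.cross b₂, 0⟩, ⟨.cross b₁, 1⟩] s := by
    rintro (_ | ⟨x, _ | ⟨y, _ | ⟨z, s⟩⟩⟩) <;>
      simp [step_succ_cons, step_succ_nil]
  simpa using run_shift_congr (by simp) (by simp) h0 a s

/-- On at least `a + 2` strands, two crossings at position `a` restore the directions. -/
theorem run_cross_cross (b b' : Bool) (a : ℕ) (s : List Bool) (h : a + 2 ≤ s.length) :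
    run [⟨.cross b, a⟩, ⟨.cross b', a⟩] s = some s := by
  induction a generalizing s with
  | zero =>
    rcases s with _ | ⟨x, _ | ⟨y, s⟩⟩ <;> simp at h ⊢
  | succ a ih =>
    cases s with
    | nil => simp at h
    | cons x s =>
      have := run_shift_one [⟨.cross b, a⟩, ⟨.cross b', a⟩] x s
      rw [ih s (by simpa [Nat.add_right_comm] using h)] at this
      simpa [Nat.add_comm 1] using this

theorem length_of_step (P : Layer) {s t : List Bool} (h : P.step s = some t) :
    t.length + P.kind.inputs = s.length + P.kind.outputs := by
  obtain ⟨c, a⟩ := P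
  induction a generalizing s t with
  | zero =>
    cases c <;> rcases s with _ | ⟨x, _ | ⟨y, s⟩⟩ <;> simp [Kind.inputs, Kind.outputs] at h ⊢
    all_goals (obtain ⟨-, rfl⟩ := h; rfl)
  | succ a ih =>
    cases s with
    | nil => simp [step_succ_nil] at h
    | cons x s =>
      simp only [step_succ_cons, Option.map_eq_some_iff] at h
      obtain ⟨t', h, rfl⟩ := h
      have := ih h
      simp only [List.length_cons] at this ⊢
      omega

theorem step_isSome_iff_of_cross (b : Bool) (a : ℕ) (s : List Bool) :
    (∃ t, Layer.step ⟨.cross b, a⟩ s = some t) ↔ a + 2 ≤ s.length := by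
  induction a generalizing s with
  | zero => rcases s with _ | ⟨x, _ | ⟨y, s⟩⟩ <;> simp
  | succ a ih =>
    cases s with
    | nil => simp [step_succ_nil]
    | cons x s =>
      have := ih s
      simp only [step_succ_cons, Option.map_eq_some_iff, List.length_cons]
      constructor
      · rintro ⟨_, t, h, -⟩
        have := this.1 ⟨t, h⟩
        omega
      · intro h
        obtain ⟨t, ht⟩ := this.2 (by omega)
        exact ⟨_, t, ht, rfl⟩

/-! ### Isotopy of words -/

/-- One local move inside a word, where both words give the same directions at the top for all
directions at the bottom. -/
def IsoStep (w w' : List Layer) : Prop :=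
  ∃ u l r v : List Layer, LocalMove l r ∧ w = u ++ l ++ v ∧ w' = u ++ r ++ v ∧
    ∀ s, run w s = run w' s

/-- Isotopy of words of layers, which are allowed to have free ends at the bottom and the top. -/
def Iso : List Layer → List Layer → Prop := Relation.EqvGen IsoStep

namespace Iso

theorem refl (w : List Layer) : Iso w w := Relation.EqvGen.refl w

theorem symm {w w' : List Layer} (h : Iso w w') : Iso w' w := Relation.EqvGen.symm _ _ h

theorem trans {w w' w'' : List Layer} (h : Iso w w') (h' : Iso w' w'') : Iso w w'' :=
  Relation.EqvGen.trans _ _ _ h h'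

instance : Trans Iso Iso Iso := ⟨trans⟩

theorem run_eq {w w' : List Layer} (h : Iso w w') (s : List Bool) : run w s = run w' s := by
  induction h with
  | rel _ _ h => obtain ⟨_, _, _, _, -, -, -, h⟩ := h; exact h s
  | refl _ => rfl
  | symm _ _ _ ih => exact ih.symm
  | trans _ _ _ _ _ ih ih' => exact ih.trans ih'

theorem append {w w' : List Layer} (h : Iso w w') (u v : List Layer) :
    Iso (u ++ w ++ v) (u ++ w' ++ v) := by
  induction h with
  | rel x y h =>
    obtain ⟨u', l, r, v', hm, rfl, rfl, h⟩ := h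
    refine Relation.EqvGen.rel _ _ ⟨u ++ u', l, r, v' ++ v, hm, by simp, by simp, fun s => ?_⟩
    rw [run_append (u ++ _), run_append (u ++ _) v, run_append u, run_append u, funext h]
  | refl _ => exact refl _
  | symm _ _ _ ih => exact ih.symm
  | trans _ _ _ _ _ ih ih' => exact ih.trans ih'

theorem append_left {w w' : List Layer} (h : Iso w w') (u : List Layer) :
    Iso (u ++ w) (u ++ w') := by simpa using h.append u []

theorem append_right {w w' : List Layer} (h : Iso w w') (v : List Layer) :
    Iso (w ++ v) (w' ++ v) := h.append [] v

theorem of_move {l r : List Layer} (h : LocalMove l r) (hr : ∀ s, run l s = run r s) : Iso l r :=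
  Relation.EqvGen.rel _ _ ⟨[], l, r, [], h, by simp, by simp, hr⟩

theorem exchange (c d : Kind) (a n : ℕ) :
    Iso [⟨c, a + d.inputs + n⟩, ⟨d, a⟩] [⟨d, a⟩, ⟨c, a + d.outputs + n⟩] :=
  of_move (.exchange c d a n) (run_exchange c d a n)

theorem slideCup (o b : Bool) (a : ℕ) :
    Iso [⟨.cup o, a⟩, ⟨.cross b, a + 1⟩] [⟨.cup o, a + 1⟩, ⟨.cross (!b), a⟩] :=
  of_move (.slideCup o b a) (run_slideCup o b a)

theorem slideCap (b : Bool) (a : ℕ) :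
    Iso [⟨.cross b, a + 1⟩, ⟨.cap, a⟩] [⟨.cross (!b), a⟩, ⟨.cap, a + 1⟩] :=
  of_move (.slideCap b a) (run_slideCap b a)

theorem reidemeisterOneCup (o b : Bool) (a : ℕ) :
    Iso [⟨.cup o, a⟩, ⟨.cross b, a⟩] [⟨.cup (!o), a⟩] :=
  of_move (.reidemeisterOneCup o b a) (run_reidemeisterOneCup o b a)

theorem reidemeisterOneCap (b : Bool) (a : ℕ) :
    Iso [⟨.cross b, a⟩, ⟨.cap, a⟩] [⟨.cap, a⟩] :=
  of_move (.reidemeisterOneCap b a) (run_reidemeisterOneCap b a)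

theorem reidemeisterThree (b₁ b₂ b₃ : Bool) (h : b₁ = b₂ ∨ b₂ = b₃) (a : ℕ) :
    Iso [⟨.cross b₁, a⟩, ⟨.cross b₂, a + 1⟩, ⟨.cross b₃, a⟩]
      [⟨.cross b₃, a + 1⟩, ⟨.cross b₂, a⟩, ⟨.cross b₁, a + 1⟩] :=
  of_move (.reidemeisterThree b₁ b₂ b₃ h a) (run_reidemeisterThree b₁ b₂ b₃ a)

/-- A second Reidemeister move is an isotopy where the word below it guarantees enough strands. -/
theorem reidemeisterTwo_after {u : List Layer} (b : Bool) (a : ℕ)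
    (h : ∀ s t, run u s = some t → a + 2 ≤ t.length) :
    Iso (u ++ [⟨.cross b, a⟩, ⟨.cross (!b), a⟩]) u := by
  refine Relation.EqvGen.rel _ _ ⟨u, _, _, [], .reidemeisterTwo b a, by simp, by simp, fun s => ?_⟩
  rw [run_append]
  cases hu : run u s with
  | none => rfl
  | some t => rw [Option.bind_some, run_cross_cross _ _ _ _ (h s t hu)]

/-- A second Reidemeister move is an isotopy where the word above it needs enough strands. -/
theorem reidemeisterTwo_before {v : List Layer} (b : Bool) (a : ℕ)
    (h : ∀ s t, run v s = some t → a + 2 ≤ s.length) :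
    Iso ([⟨.cross b, a⟩, ⟨.cross (!b), a⟩] ++ v) v := by
  refine Relation.EqvGen.rel _ _ ⟨[], _, _, v, .reidemeisterTwo b a, by simp, by simp, fun s => ?_⟩
  rw [run_append]
  by_cases hs : a + 2 ≤ s.length
  · rw [run_cross_cross _ _ _ _ hs, Option.bind_some]
  · have h1 : run v s = none := by
      cases hv : run v s with
      | none => rfl
      | some t => exact absurd (h s t hv) hs
    have h2 : Layer.step ⟨.cross b, a⟩ s = none := by
      cases hv : Layer.step ⟨.cross b, a⟩ s with
      | none => rfl
      | some t => exact absurd ((step_isSome_iff_of_cross b a s).1 ⟨t, hv⟩) hs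
    simp [h1, h2]

/-- Isotopic closed words are diagrams of the same link. -/
theorem link_eq {w w' : List Layer} (h : Iso w w') (hw : run w [] = some [])
    (hw' : run w' [] = some []) :
    (Quot.mk Diagram.Move ⟨w, hw⟩ : Link) = Quot.mk Diagram.Move ⟨w', hw'⟩ := by
  induction h with
  | rel _ _ h =>
    obtain ⟨u, l, r, v, hm, h1, h2, -⟩ := h
    exact Quot.sound ⟨u, l, r, v, hm, h1, h2⟩
  | refl _ => rfl
  | symm _ _ _ ih => exact (ih hw' hw).symm
  | trans _ y _ h1 _ ih ih' =>
    have hy : run y [] = some [] := by rw [← Iso.run_eq h1]; exact hw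
    exact (ih hw hy).trans (ih' hy hw')

end Iso

/-! ### Minima at the bottom and maxima at the top -/

/-- A word of crossings. -/
def IsCrossWord (w : List Layer) : Prop := ∀ P ∈ w, ∃ b a, P = ⟨.cross b, a⟩

/-- A word without maxima. -/
def IsCapFree (w : List Layer) : Prop := ∀ P ∈ w, P.kind ≠ .cap

theorem IsCrossWord.isCapFree {w : List Layer} (h : IsCrossWord w) : IsCapFree w := by
  intro P hP
  obtain ⟨b, a, rfl⟩ := h P hP
  simp

theorem IsCrossWord.append {w w' : List Layer} (h : IsCrossWord w) (h' : IsCrossWord w') :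
    IsCrossWord (w ++ w') := fun P hP => (List.mem_append.1 hP).elim (h P) (h' P)

theorem IsCapFree.append {w w' : List Layer} (h : IsCapFree w) (h' : IsCapFree w') :
    IsCapFree (w ++ w') := fun P hP => (List.mem_append.1 hP).elim (h P) (h' P)

theorem IsCrossWord.map_shift {w : List Layer} (h : IsCrossWord w) (n : ℕ) :
    IsCrossWord (w.map (Layer.shift n)) := by
  intro P hP
  obtain ⟨P', hP', rfl⟩ := List.mem_map.1 hP
  obtain ⟨b, a, rfl⟩ := h P' hP'
  exact ⟨b, _, rfl⟩

theorem IsCapFree.map_shift {w : List Layer} (h : IsCapFree w) (n : ℕ) :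
    IsCapFree (w.map (Layer.shift n)) := by
  intro P hP
  obtain ⟨P', hP', rfl⟩ := List.mem_map.1 hP
  exact h P' hP'

/-- A maximum at the far left rises above anything. -/
theorem iso_cap_zero_append (w : List Layer) :
    Iso (⟨.cap, 0⟩ :: w) (w.map (Layer.shift 2) ++ [⟨.cap, 0⟩]) := by
  induction w with
  | nil => exact Iso.refl _
  | cons P w ih =>
    obtain ⟨c, a⟩ := P
    have h1 : Iso [⟨.cap, 0⟩, ⟨c, a⟩] [⟨c, 2 + a⟩, ⟨.cap, 0⟩] := by
      simpa [Kind.inputs, Kind.outputs] using (Iso.exchange c .cap 0 a).symm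
    simpa using (h1.append_right w).trans (ih.append_left [⟨c, 2 + a⟩])

/-- A minimum at the far left sinks below anything. -/
theorem iso_append_cup_zero (o : Bool) (w : List Layer) :
    Iso (w ++ [⟨.cup o, 0⟩]) (⟨.cup o, 0⟩ :: w.map (Layer.shift 2)) := by
  induction w with
  | nil => exact Iso.refl _
  | cons P w ih =>
    obtain ⟨c, a⟩ := P
    have h1 : Iso [⟨c, a⟩, ⟨.cup o, 0⟩] [⟨.cup o, 0⟩, ⟨c, 2 + a⟩] := by
      simpa [Kind.inputs, Kind.outputs] using Iso.exchange c (.cup o) 0 a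
    simpa using (ih.append_left [⟨c, a⟩]).trans (h1.append_right (w.map (Layer.shift 2)))

theorem iso_replicate_cap_append (k : ℕ) (w : List Layer) :
    Iso (List.replicate k ⟨.cap, 0⟩ ++ w)
      (w.map (Layer.shift (2 * k)) ++ List.replicate k ⟨.cap, 0⟩) := by
  induction k generalizing w with
  | zero => simpa [Layer.shift_zero] using Iso.refl _
  | succ k ih =>
    have h1 := (iso_cap_zero_append w).append_left (List.replicate k ⟨.cap, 0⟩)
    have h2 := (ih (w.map (Layer.shift 2))).append_right [⟨.cap, 0⟩]
    have e : (w.map (Layer.shift 2)).map (Layer.shift (2 * k)) =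
        w.map (Layer.shift (2 * (k + 1))) := by
      rw [List.map_map]; congr 1; funext P
      simp only [Layer.shift, Function.comp, Layer.mk.injEq, true_and]; omega
    rw [e] at h2
    have := h1.trans (by simpa using h2)
    simpa [List.replicate_succ'] using this

/-- A maximum slides to the far left, under or over the strands on its left. -/
theorem exists_iso_cap_zero (a : ℕ) :
    ∃ w, IsCrossWord w ∧ Iso [⟨.cap, a⟩] (w ++ [⟨.cap, 0⟩]) := by
  induction a with
  | zero => exact ⟨[], by simp [IsCrossWord], Iso.refl _⟩
  | succ a ih =>
    obtain ⟨w, hw, h⟩ := ih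
    have h1 : Iso ([⟨.cross true, a⟩, ⟨.cross (!true), a⟩] ++ [⟨.cap, a + 1⟩]) [⟨.cap, a + 1⟩] := by
      refine Iso.reidemeisterTwo_before _ _ fun s t hs => ?_
      have h2 : run [⟨.cap, a + 1⟩] s = run [⟨.cross true, a + 1⟩, ⟨.cap, a + 1⟩] s :=
        (run_reidemeisterOneCap _ _ _).symm
      rw [hs, run_cons] at h2
      cases h3 : Layer.step ⟨.cross true, a + 1⟩ s with
      | none => simp [h3] at h2
      | some t =>
        have := (step_isSome_iff_of_cross _ _ _).1 ⟨t, h3⟩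
        omega
    have h2 := (Iso.slideCap true a).symm.append_left [⟨.cross true, a⟩]
    have h3 := h.append_left [⟨.cross true, a⟩, ⟨.cross true, a + 1⟩]
    refine ⟨[⟨.cross true, a⟩, ⟨.cross true, a + 1⟩] ++ w,
      IsCrossWord.append (by simp [IsCrossWord]) hw, ?_⟩
    exact h1.symm.trans (h2.trans (by simpa using h3))

/-- A minimum slides to the far left, under or over the strands on its left. -/
theorem exists_iso_cup_zero (o : Bool) (a : ℕ) :
    ∃ w, IsCrossWord w ∧ Iso [⟨.cup o, a⟩] (⟨.cup o, 0⟩ :: w) := by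
  induction a with
  | zero => exact ⟨[], by simp [IsCrossWord], Iso.refl _⟩
  | succ a ih =>
    obtain ⟨w, hw, h⟩ := ih
    have h1 : Iso ([⟨.cup o, a + 1⟩] ++ [⟨.cross true, a⟩, ⟨.cross (!true), a⟩])
        [⟨.cup o, a + 1⟩] := by
      refine Iso.reidemeisterTwo_after _ _ fun s t hs => ?_
      simp only [run_cons, Option.bind_eq_some_iff, run_nil, Option.some.injEq] at hs
      obtain ⟨t, hs, rfl⟩ := hs
      simp only [Layer.step] at hs
      split_ifs at hs with h2
      have := length_of_step ⟨.cup o, a + 1⟩ (s := s) (t := t) (by simpa [Layer.step, h2] using hs)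
      simp only [Kind.inputs, Kind.outputs] at this
      omega
    have h2 : Iso [⟨.cup o, a + 1⟩, ⟨.cross true, a⟩] [⟨.cup o, a⟩, ⟨.cross false, a + 1⟩] :=
      (Iso.slideCup o false a).symm
    refine ⟨w ++ [⟨.cross false, a + 1⟩, ⟨.cross false, a⟩],
      hw.append (by simp [IsCrossWord]), ?_⟩
    refine h1.symm.trans ((by simpa using h2.append_right [⟨.cross false, a⟩] :
      Iso _ [⟨.cup o, a⟩, ⟨.cross false, a + 1⟩, ⟨.cross false, a⟩]).trans ?_)
    simpa using h.append_right [⟨.cross false, a + 1⟩, ⟨.cross false, a⟩]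

/-- The number of maxima of a word. -/
def capCount (w : List Layer) : ℕ :=
  w.countP fun P => match P.kind with
    | .cap => true
    | _ => false

/-- All maxima can be moved to the far left of the top, one above the other; new crossings arise
where they pass the strands on their left. -/
theorem exists_iso_caps_at_top (w : List Layer) :
    ∃ w', IsCapFree w' ∧ Iso w (w' ++ List.replicate (capCount w) ⟨.cap, 0⟩) := by
  induction w using List.reverseRecOn with
  | nil => exact ⟨[], by simp [IsCapFree], Iso.refl _⟩
  | append_singleton w P ih =>
    obtain ⟨w', hw', h⟩ := ih
    have h1 := h.append_right [P]
    by_cases hP : P.kind = .cap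
    · obtain ⟨c, a⟩ := P
      obtain rfl : c = .cap := hP
      obtain ⟨x, hx, h2⟩ := exists_iso_cap_zero a
      have h3 := (iso_replicate_cap_append (capCount w) x).append w' [⟨.cap, 0⟩]
      refine ⟨w' ++ x.map (Layer.shift (2 * capCount w)),
        hw'.append (hx.map_shift _).isCapFree, h1.trans ?_⟩
      have h4 := (h2.append_left (w' ++ List.replicate (capCount w) ⟨.cap, 0⟩)).trans
        (by simpa using h3)
      have e : capCount (w ++ [⟨.cap, a⟩]) = capCount w + 1 := by simp [capCount]
      rw [e, List.replicate_succ']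
      simpa using h4
    · have e : capCount (w ++ [P]) = capCount w := by
        obtain ⟨c, a⟩ := P
        cases c <;> simp_all [capCount]
      have h3 := (iso_replicate_cap_append (capCount w) [P]).append_left w'
      refine ⟨w' ++ [P].map (Layer.shift (2 * capCount w)), hw'.append ?_, ?_⟩
      · exact IsCapFree.map_shift (by simpa [IsCapFree] using hP) _
      · rw [e]
        exact h1.trans (by simpa using h3)

/-- All minima can be moved to the far left of the bottom; above them, only crossings remain. -/
theorem IsCapFree.exists_iso_cups_at_bottom {w : List Layer} (hw : IsCapFree w) :
    ∃ (os : List Bool) (x : List Layer), IsCrossWord x ∧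
      Iso w (os.map (fun o => ⟨.cup o, 0⟩) ++ x) := by
  induction w using List.reverseRecOn with
  | nil => exact ⟨[], [], by simp [IsCrossWord], Iso.refl _⟩
  | append_singleton w P ih =>
    obtain ⟨os, x, hx, h⟩ := ih fun Q hQ => hw Q (by simp [hQ])
    have h1 := h.append_right [P]
    obtain ⟨c, a⟩ := P
    cases c with
    | cap => exact absurd rfl (hw ⟨.cap, a⟩ (by simp))
    | cross b =>
      exact ⟨os, x ++ [⟨.cross b, a⟩], hx.append (by simp [IsCrossWord]), by simpa using h1⟩
    | cup o =>
      obtain ⟨y, hy, h2⟩ := exists_iso_cup_zero o a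
      refine ⟨os ++ [o], x.map (Layer.shift 2) ++ y, (hx.map_shift 2).append hy, h1.trans ?_⟩
      have h3 := h2.append_left (os.map (fun o => ⟨.cup o, 0⟩) ++ x)
      have h4 := (iso_append_cup_zero o x).append (os.map (fun o => ⟨.cup o, 0⟩)) y
      exact h3.trans (by simpa using h4)

/-! ### Braid words on four strands above two minima -/

/-- A word in the standard generators of the braid group on four strands and their inverses:
`(i, b)` is the crossing `.cross b` of the strands at the positions `i` and `i + 1`. -/
abbrev BraidWord : Type := List (Fin 3 × Bool)

/-- The layers of a braid word. -/
def BraidWord.layers (β : BraidWord) : List Layer := β.map fun p => ⟨.cross p.2, p.1⟩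

@[simp] theorem BraidWord.layers_nil : BraidWord.layers [] = [] := rfl

@[simp] theorem BraidWord.layers_cons (p : Fin 3 × Bool) (β : BraidWord) :
    BraidWord.layers (p :: β) = ⟨.cross p.2, p.1⟩ :: BraidWord.layers β := rfl

@[simp] theorem BraidWord.layers_append (β γ : BraidWord) :
    BraidWord.layers (β ++ γ) = BraidWord.layers β ++ BraidWord.layers γ := List.map_append

/-- Two minima side by side with a braid word on top; the left minimum has the left branch of
direction `o₂`, the right one that of direction `o₁`. -/
def plat (o₁ o₂ : Bool) (β : BraidWord) : List Layer :=
  [⟨.cup o₁, 0⟩, ⟨.cup o₂, 0⟩] ++ β.layers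

theorem plat_append (o₁ o₂ : Bool) (β γ : BraidWord) :
    plat o₁ o₂ (β ++ γ) = plat o₁ o₂ β ++ γ.layers := by simp [plat]

theorem exists_run_layers (β : BraidWord) (s : List Bool) (h : 4 ≤ s.length) :
    ∃ t, run β.layers s = some t ∧ t.length = s.length := by
  induction β generalizing s with
  | nil => exact ⟨s, rfl, rfl⟩
  | cons p β ih =>
    obtain ⟨t, ht⟩ := (step_isSome_iff_of_cross p.2 p.1 s).2 (by omega)
    have hl := length_of_step _ ht
    simp only [Kind.inputs, Kind.outputs] at hl
    obtain ⟨t', h', hl'⟩ := ih t (by omega)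
    exact ⟨t', by simp [ht, h'], by omega⟩

theorem exists_run_plat (o₁ o₂ : Bool) (β : BraidWord) (s : List Bool) :
    ∃ t, run (plat o₁ o₂ β) s = some t ∧ t.length = s.length + 4 := by
  simpa [plat] using exists_run_layers β (o₂ :: (!o₂) :: o₁ :: (!o₁) :: s) (by simp)

/-- Each of the oriented tangles made of two minima and `β` on top is isotopic to one of those made
of two minima and `γ` on top. -/
def BraidWord.Refines (β γ : BraidWord) : Prop :=
  ∀ o₁ o₂, ∃ o₁' o₂', Iso (plat o₁ o₂ β) (plat o₁' o₂' γ)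

theorem BraidWord.Refines.of_iso {β γ : BraidWord}
    (h : ∀ o₁ o₂, Iso (plat o₁ o₂ β) (plat o₁ o₂ γ)) :
    β.Refines γ := fun o₁ o₂ => ⟨o₁, o₂, h o₁ o₂⟩

theorem BraidWord.Refines.append {β γ : BraidWord} (h : β.Refines γ) (δ : BraidWord) :
    BraidWord.Refines (β ++ δ) (γ ++ δ) := by
  intro o₁ o₂
  obtain ⟨o₁', o₂', h⟩ := h o₁ o₂
  exact ⟨o₁', o₂', by simpa [plat_append] using h.append_right δ.layers⟩

/-- Braid words are identified if they give the same unoriented tangle above two minima. -/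
instance tangleSetoid : Setoid BraidWord where
  r β γ := β.Refines γ ∧ γ.Refines β
  iseqv :=
    { refl := fun _ => ⟨.of_iso fun _ _ => Iso.refl _, .of_iso fun _ _ => Iso.refl _⟩
      symm := fun h => ⟨h.2, h.1⟩
      trans := by
        have key : ∀ {β γ δ : BraidWord}, β.Refines γ → γ.Refines δ → β.Refines δ := by
          intro β γ δ h h' o₁ o₂
          obtain ⟨p₁, p₂, h1⟩ := h o₁ o₂
          obtain ⟨q₁, q₂, h2⟩ := h' p₁ p₂
          exact ⟨q₁, q₂, h1.trans h2⟩
        exact fun {_ _ _} h h' => ⟨key h.1 h'.1, key h'.2 h.2⟩ }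

/-- Rational tangles: unoriented tangles made of two minima and a braid on top. -/
def Tangle : Type := Quotient tangleSetoid

/-- The tangle of a braid word. -/
def Tangle.mk (β : BraidWord) : Tangle := Quotient.mk tangleSetoid β

theorem Tangle.mk_eq_of_iso {β γ : BraidWord}
    (h : ∀ o₁ o₂, Iso (plat o₁ o₂ β) (plat o₁ o₂ γ)) : Tangle.mk β = Tangle.mk γ :=
  Quotient.sound ⟨.of_iso h, .of_iso fun o₁ o₂ => (h o₁ o₂).symm⟩

theorem Tangle.exists_iso_of_mk_eq {β γ : BraidWord} (h : Tangle.mk β = Tangle.mk γ)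
    (o₁ o₂ : Bool) : ∃ o₁' o₂', Iso (plat o₁ o₂ β) (plat o₁' o₂' γ) :=
  (Quotient.exact h).1 o₁ o₂

theorem Tangle.mk_append_congr {β γ : BraidWord} (h : Tangle.mk β = Tangle.mk γ) (δ : BraidWord) :
    Tangle.mk (β ++ δ) = Tangle.mk (γ ++ δ) :=
  have h := Quotient.exact h
  Quotient.sound ⟨h.1.append δ, h.2.append δ⟩

theorem Tangle.mk_append_cancel (β : BraidWord) (i : Fin 3) (b : Bool) :
    Tangle.mk (β ++ [(i, b), (i, !b)]) = Tangle.mk β := by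
  refine mk_eq_of_iso fun o₁ o₂ => ?_
  rw [plat_append]
  refine Iso.reidemeisterTwo_after b i fun s t h => ?_
  obtain ⟨t', h', hl⟩ := exists_run_plat o₁ o₂ β s
  obtain rfl : t = t' := by simpa [h] using h'
  omega

/-- Adding one crossing on top of a tangle. -/
def Tangle.add (p : Fin 3 × Bool) : Tangle → Tangle :=
  Quotient.map' (· ++ [p]) fun _ _ h => ⟨h.1.append [p], h.2.append [p]⟩

/-- The action of the generators of the braid group on tangles. -/
def Tangle.σ (i : Fin 3) : Equiv.Perm Tangle where
  toFun := Tangle.add (i, true)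
  invFun := Tangle.add (i, false)
  left_inv := by
    rintro ⟨β⟩
    change Tangle.mk ((β ++ [(i, true)]) ++ [(i, false)]) = Tangle.mk β
    simpa using Tangle.mk_append_cancel β i true
  right_inv := by
    rintro ⟨β⟩
    change Tangle.mk ((β ++ [(i, false)]) ++ [(i, true)]) = Tangle.mk β
    simpa using Tangle.mk_append_cancel β i false

namespace Tangle

theorem mk_append_true (β : BraidWord) (i : Fin 3) : mk (β ++ [(i, true)]) = σ i (mk β) := rfl

theorem mk_append_false (β : BraidWord) (i : Fin 3) :
    mk (β ++ [(i, false)]) = (σ i)⁻¹ (mk β) := rfl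

@[elab_as_elim]
theorem induction_on {p : Tangle → Prop} (q : Tangle) (h0 : p (mk []))
    (h1 : ∀ i q, p q → p (σ i q)) (h2 : ∀ i q, p q → p ((σ i)⁻¹ q)) : p q := by
  obtain ⟨β⟩ := q
  change p (mk β)
  induction β using List.reverseRecOn with
  | nil => exact h0
  | append_singleton β s ih =>
    obtain ⟨i, b⟩ := s
    cases b
    · exact h2 i _ ih
    · exact h1 i _ ih

theorem perm_ext {f g : Equiv.Perm Tangle} (h : ∀ β, f (mk β) = g (mk β)) : f = g :=
  Equiv.ext fun q => by obtain ⟨β⟩ := q; exact h β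

theorem σ_braid_zero_one : σ 0 * σ 1 * σ 0 = σ 1 * σ 0 * σ 1 := by
  refine perm_ext fun β => ?_
  change mk (((β ++ [(0, true)]) ++ [(1, true)]) ++ [(0, true)]) =
    mk (((β ++ [(1, true)]) ++ [(0, true)]) ++ [(1, true)])
  refine mk_eq_of_iso fun o₁ o₂ => ?_
  simpa [plat] using (Iso.reidemeisterThree true true true (.inl rfl) 0).append_left (plat o₁ o₂ β)

theorem σ_braid_one_two : σ 1 * σ 2 * σ 1 = σ 2 * σ 1 * σ 2 := by
  refine perm_ext fun β => ?_
  change mk (((β ++ [(1, true)]) ++ [(2, true)]) ++ [(1, true)]) =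
    mk (((β ++ [(2, true)]) ++ [(1, true)]) ++ [(2, true)])
  refine mk_eq_of_iso fun o₁ o₂ => ?_
  simpa [plat] using (Iso.reidemeisterThree true true true (.inl rfl) 1).append_left (plat o₁ o₂ β)

theorem σ_comm_zero_two : σ 0 * σ 2 = σ 2 * σ 0 := by
  refine perm_ext fun β => ?_
  change mk ((β ++ [(2, true)]) ++ [(0, true)]) = mk ((β ++ [(0, true)]) ++ [(2, true)])
  refine mk_eq_of_iso fun o₁ o₂ => ?_
  simpa [plat, Kind.inputs, Kind.outputs] using
    (Iso.exchange (.cross true) (.cross true) 0 0).append_left (plat o₁ o₂ β)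

/-- The two ways of building two minima side by side. -/
theorem iso_two_cups (o₁ o₂ : Bool) :
    Iso [⟨.cup o₁, 0⟩, ⟨.cup o₂, 0⟩] [⟨.cup o₂, 0⟩, ⟨.cup o₁, 2⟩] := by
  simpa [Kind.inputs, Kind.outputs] using Iso.exchange (.cup o₁) (.cup o₂) 0 0

theorem σ_zero_mk_nil : σ 0 (mk []) = mk [] := by
  have key : ∀ o₁ o₂, Iso (plat o₁ o₂ [(0, true)]) (plat o₁ (!o₂) []) := fun o₁ o₂ => by
    simpa [plat] using (Iso.reidemeisterOneCup o₂ true 0).append_left [⟨.cup o₁, 0⟩]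
  refine Quotient.sound ⟨fun o₁ o₂ => ⟨_, _, key o₁ o₂⟩, fun o₁ o₂ => ⟨o₁, !o₂, ?_⟩⟩
  simpa using (key o₁ (!o₂)).symm

theorem σ_two_mk_nil : σ 2 (mk []) = mk [] := by
  have key : ∀ o₁ o₂, Iso (plat o₁ o₂ [(2, true)]) (plat (!o₁) o₂ []) := fun o₁ o₂ => by
    have h1 := (iso_two_cups o₁ o₂).append_right [⟨.cross true, 2⟩]
    have h2 := (Iso.reidemeisterOneCup o₁ true 2).append_left [⟨.cup o₂, 0⟩]
    simpa [plat] using (h1.trans h2).trans (iso_two_cups (!o₁) o₂).symm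
  refine Quotient.sound ⟨fun o₁ o₂ => ⟨_, _, key o₁ o₂⟩, fun o₁ o₂ => ⟨!o₁, o₂, ?_⟩⟩
  simpa using (key (!o₁) o₂).symm

/-- If the left minimum is pulled across a leg of the right one, it ends up inside it. -/
theorem iso_nested_left (o₁ o₂ b : Bool) :
    Iso (plat o₁ o₂ [(1, b), (0, b)]) [⟨.cup o₁, 0⟩, ⟨.cup o₂, 1⟩] := by
  have h1 := (Iso.slideCup o₂ b 0).append [⟨.cup o₁, 0⟩] [⟨.cross b, 0⟩]
  have h2 : Iso ([⟨.cup o₁, 0⟩, ⟨.cup o₂, 1⟩] ++ [⟨.cross (!b), 0⟩, ⟨.cross (!!b), 0⟩])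
      [⟨.cup o₁, 0⟩, ⟨.cup o₂, 1⟩] := by
    refine Iso.reidemeisterTwo_after (!b) 0 fun s t h => ?_
    simp [step_succ_cons] at h
    subst h
    simp
  simpa [plat] using h1.trans (by simpa using h2)

/-- If the right minimum is pulled across a leg of the left one, it ends up inside it. -/
theorem iso_nested_right (o₁ o₂ b : Bool) :
    Iso (plat o₁ o₂ [(1, b), (2, b)]) [⟨.cup o₂, 0⟩, ⟨.cup o₁, 1⟩] := by
  have h0 := (iso_two_cups o₁ o₂).append_right [⟨.cross b, 1⟩, ⟨.cross b, 2⟩]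
  have h1 := (Iso.slideCup o₁ (!b) 1).symm.append [⟨.cup o₂, 0⟩] [⟨.cross b, 2⟩]
  have h2 : Iso ([⟨.cup o₂, 0⟩, ⟨.cup o₁, 1⟩] ++ [⟨.cross (!b), 2⟩, ⟨.cross (!!b), 2⟩])
      [⟨.cup o₂, 0⟩, ⟨.cup o₁, 1⟩] := by
    refine Iso.reidemeisterTwo_after (!b) 2 fun s t h => ?_
    simp [step_succ_cons] at h
    subst h
    simp
  simpa [plat] using h0.trans ((by simpa using h1 : Iso _ _).trans (by simpa using h2))

theorem σ_inv_zero_σ_inv_one_mk_nil :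
    (σ 0)⁻¹ ((σ 1)⁻¹ (mk [])) = (σ 2)⁻¹ ((σ 1)⁻¹ (mk [])) := by
  refine Quotient.sound ⟨fun o₁ o₂ => ⟨o₂, o₁, ?_⟩, fun o₁ o₂ => ⟨o₂, o₁, ?_⟩⟩
  · exact (iso_nested_left o₁ o₂ false).trans (iso_nested_right o₂ o₁ false).symm
  · exact (iso_nested_right o₁ o₂ false).trans (iso_nested_left o₂ o₁ false).symm

/-- The two minima change places when one of them is pulled across the other. -/
theorem σ_swap_mk_nil : σ 1 (σ 2 (σ 0 (σ 1 (mk [])))) = mk [] := by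
  have key : ∀ o₁ o₂, Iso (plat o₁ o₂ [(1, true), (0, true), (2, true), (1, true)])
      (plat o₂ o₁ []) := fun o₁ o₂ => by
    have h1 := (iso_nested_left o₁ o₂ true).append_right [⟨.cross true, 2⟩, ⟨.cross true, 1⟩]
    have h2 := (Iso.slideCup o₂ true 1).append [⟨.cup o₁, 0⟩] [⟨.cross true, 1⟩]
    have h3 : Iso ([⟨.cup o₁, 0⟩, ⟨.cup o₂, 2⟩] ++ [⟨.cross (!true), 1⟩, ⟨.cross (!!true), 1⟩])
        [⟨.cup o₁, 0⟩, ⟨.cup o₂, 2⟩] := by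
      refine Iso.reidemeisterTwo_after (!true) 1 fun s t h => ?_
      simp [step_succ_cons] at h
      subst h
      simp
    have h4 := (iso_two_cups o₂ o₁).symm
    simpa [plat] using (by simpa [plat] using h1 : Iso _ _).trans
      ((by simpa using h2 : Iso _ _).trans ((by simpa using h3 : Iso _ _).trans h4))
  exact Quotient.sound ⟨fun o₁ o₂ => ⟨_, _, key o₁ o₂⟩, fun o₁ o₂ => ⟨_, _, (key o₂ o₁).symm⟩⟩

end Tangle

/-! ### The action of the braid group on rational tangles -/

section BraidRelations

variable {G : Type*} [Group G] {a b c : G}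

theorem inv_mul_mul_of_braid (h : a * b * a = b * a * b) : b⁻¹ * a * b = a * b * a⁻¹ := by
  rw [mul_assoc, inv_mul_eq_iff_eq_mul, ← mul_assoc, ← mul_assoc, eq_mul_inv_iff_mul_eq, h]

/-- With `u = c * a⁻¹` and `v = b * u * b⁻¹` for generators `a`, `b`, `c` of the braid group on
four strands: conjugation by `a` maps `v` into the subgroup generated by `u` and `v`. -/
theorem conj_fst_of_braid (hab : a * b * a = b * a * b) (hbc : b * c * b = c * b * c) :
    a * (b * (c * a⁻¹) * b⁻¹) * a⁻¹ = (c * a⁻¹)⁻¹ * (b * (c * a⁻¹) * b⁻¹) := by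
  have h1 : a⁻¹ * b⁻¹ * a⁻¹ = b⁻¹ * a⁻¹ * b⁻¹ := by
    have := congrArg (·⁻¹) hab
    simpa [mul_assoc] using this
  have h2 : b * c * b⁻¹ = c⁻¹ * b * c := by
    rw [mul_inv_eq_iff_eq_mul, mul_assoc, mul_assoc, eq_inv_mul_iff_mul_eq, ← mul_assoc,
      ← mul_assoc, hbc]
  calc a * (b * (c * a⁻¹) * b⁻¹) * a⁻¹ = a * (b * c) * (a⁻¹ * b⁻¹ * a⁻¹) := by group
    _ = a * (b * c * b⁻¹) * a⁻¹ * b⁻¹ := by rw [h1]; group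
    _ = (c * a⁻¹)⁻¹ * (b * (c * a⁻¹) * b⁻¹) := by rw [h2]; group

/-- With `u = c * a⁻¹` and `v = b * u * b⁻¹` for generators `a`, `b`, `c` of the braid group on
four strands: conjugation by `b⁻¹` maps `u` into the subgroup generated by `u` and `v`. -/
theorem conj_snd_of_braid (hab : a * b * a = b * a * b) (hbc : b * c * b = c * b * c)
    (hac : a * c = c * a) :
    b⁻¹ * (c * a⁻¹) * b = (c * a⁻¹) * (b * (c * a⁻¹) * b⁻¹)⁻¹ * (c * a⁻¹) := by
  have h1 : b⁻¹ * a⁻¹ * b = a * b⁻¹ * a⁻¹ := by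
    have := congrArg (·⁻¹) (inv_mul_mul_of_braid hab)
    simpa [mul_assoc] using this
  have h2 : b⁻¹ * c * b = c * b * c⁻¹ := inv_mul_mul_of_braid hbc.symm
  calc b⁻¹ * (c * a⁻¹) * b = (b⁻¹ * c * b) * (b⁻¹ * a⁻¹ * b) := by group
    _ = c * b * (c⁻¹ * a) * b⁻¹ * a⁻¹ := by rw [h1, h2]; group
    _ = c * b * (a * c⁻¹) * b⁻¹ * a⁻¹ := by
      rw [show c⁻¹ * a = a * c⁻¹ by rw [inv_mul_eq_iff_eq_mul, ← mul_assoc, ← hac]; group]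
    _ = (c * a⁻¹) * (a * (b * (c * a⁻¹) * b⁻¹) * a⁻¹)⁻¹ := by group
    _ = (c * a⁻¹) * (b * (c * a⁻¹) * b⁻¹)⁻¹ * (c * a⁻¹) := by
      rw [conj_fst_of_braid hab hbc]; group

/-- The square of the half twist is central. -/
theorem commute_halfTwist_sq (hab : a * b * a = b * a * b) :
    Commute (a * b * a * (a * b * a)) a ∧ Commute (a * b * a * (a * b * a)) b := by
  have h1 : a * b * a * a = b * (a * b * a) := by
    rw [hab, mul_assoc (b * a), mul_assoc b, ← mul_assoc a, hab]
  have h2 : a * b * a * b = a * (a * b * a) := by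
    rw [mul_assoc, mul_assoc, ← mul_assoc b, ← hab]
  constructor
  · change a * b * a * (a * b * a) * a = a * (a * b * a * (a * b * a))
    rw [mul_assoc, h1, ← mul_assoc, h2, mul_assoc]
  · change a * b * a * (a * b * a) * b = b * (a * b * a * (a * b * a))
    rw [mul_assoc, h2, ← mul_assoc, h1, mul_assoc]

end BraidRelations

namespace Tangle

/-- The property of a tangle that the elements `u`, `v` of `conj_fst_of_braid` fix it. -/
def IsFlypeInvariant (q : Tangle) : Prop :=
  (σ 2 * (σ 0)⁻¹) q = q ∧ (σ 1 * (σ 2 * (σ 0)⁻¹) * (σ 1)⁻¹) q = q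

/-- The elements `u` and `v` fix every rational tangle: they fix the trivial one, and the subgroup
generated by them is normalized by the generators of the braid group. -/
theorem isFlypeInvariant (q : Tangle) : IsFlypeInvariant q := by
  have hab := σ_braid_zero_one
  have hbc := σ_braid_one_two
  have hac := σ_comm_zero_two
  set a := σ 0 with ha
  set b := σ 1 with hb
  set c := σ 2 with hc
  set u := c * a⁻¹ with hu
  set v := b * u * b⁻¹ with hv
  have e1 : a * v * a⁻¹ = u⁻¹ * v := conj_fst_of_braid hab hbc
  have e2 : a * u * a⁻¹ = u := by rw [hu, ← mul_assoc, hac]; group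
  have e3 : b⁻¹ * u * b = u * v⁻¹ * u := conj_snd_of_braid hab hbc hac
  have inv_fix : ∀ {f : Equiv.Perm Tangle} {q}, f q = q → f⁻¹ q = q := fun {f q} h => by
    rw [Equiv.Perm.inv_eq_iff_eq, h]
  -- If `x * g = g * y`, then `x` fixes `g q` as soon as `y` fixes `q`.
  have transport : ∀ {x y g : Equiv.Perm Tangle} {q}, x * g = g * y → y q = q → x (g q) = g q := by
    intro x y g q h h'
    rw [← Equiv.Perm.mul_apply, h, Equiv.Perm.mul_apply, h']
  have ha1 : ∀ q, IsFlypeInvariant q → IsFlypeInvariant (a q) := by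
    rintro q ⟨h1, h2⟩
    change u q = q at h1
    change v q = q at h2
    refine ⟨transport (y := u) ?_ h1, transport (y := u * v) ?_ ?_⟩
    · change u * a = a * u
      rw [← e2]; nth_rw 1 [← e2]; group
    · change v * a = a * (u * v)
      have : u = a⁻¹ * u * a := by nth_rw 2 [← e2]; group
      have e4 : v = u * (a * v * a⁻¹) := by rw [e1]; group
      nth_rw 1 [e4]
      nth_rw 1 [← e2]; group
    · rw [Equiv.Perm.mul_apply, h2, h1]
  have ha2 : ∀ q, IsFlypeInvariant q → IsFlypeInvariant (a⁻¹ q) := by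
    rintro q ⟨h1, h2⟩
    change u q = q at h1
    change v q = q at h2
    refine ⟨transport (y := u) ?_ h1, transport (y := u⁻¹ * v) ?_ ?_⟩
    · change u * a⁻¹ = a⁻¹ * u
      nth_rw 2 [← e2]; group
    · change v * a⁻¹ = a⁻¹ * (u⁻¹ * v)
      rw [← e1]; group
    · rw [Equiv.Perm.mul_apply, h2, inv_fix h1]
  have hb1 : ∀ q, IsFlypeInvariant q → IsFlypeInvariant (b q) := by
    rintro q ⟨h1, h2⟩
    change u q = q at h1
    change v q = q at h2
    refine ⟨transport (y := u * v⁻¹ * u) ?_ ?_, transport (y := u) ?_ h1⟩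
    · change u * b = b * (u * v⁻¹ * u)
      rw [← e3]; group
    · rw [Equiv.Perm.mul_apply, Equiv.Perm.mul_apply, h1, inv_fix h2, h1]
    · change v * b = b * u
      rw [hv]; group
  have hb2 : ∀ q, IsFlypeInvariant q → IsFlypeInvariant (b⁻¹ q) := by
    rintro q ⟨h1, h2⟩
    change u q = q at h1
    change v q = q at h2
    refine ⟨transport (y := v) ?_ h2, transport (y := v * u⁻¹ * v) ?_ ?_⟩
    · change u * b⁻¹ = b⁻¹ * v
      rw [hv]; group
    · change v * b⁻¹ = b⁻¹ * (v * u⁻¹ * v)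
      have e5 : v = u * (b⁻¹ * u * b)⁻¹ * u := by rw [e3]; group
      nth_rw 1 [e5]
      rw [hv]; group
    · rw [Equiv.Perm.mul_apply, Equiv.Perm.mul_apply, h2, inv_fix h1, h2]
  have hc1 : ∀ q, IsFlypeInvariant q → IsFlypeInvariant (c q) := by
    intro q h
    have h1 : u (a q) = a q := (ha1 q h).1
    have h2 : u (a q) = c q := by simp [hu]
    rw [← h2, h1]
    exact ha1 q h
  have hc2 : ∀ q, IsFlypeInvariant q → IsFlypeInvariant (c⁻¹ q) := by
    intro q h
    have h1 : u⁻¹ q = q := inv_fix h.1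
    have h2 : a⁻¹ (u⁻¹ q) = c⁻¹ q := by simp [hu]
    rw [← h2, h1]
    exact ha2 q h
  refine induction_on q ⟨?_, ?_⟩ (fun i q h => ?_) fun i q h => ?_
  · change c (a⁻¹ (mk [])) = mk []
    rw [inv_fix σ_zero_mk_nil]
    exact σ_two_mk_nil
  · change b (c (a⁻¹ (b⁻¹ (mk [])))) = mk []
    have h1 : a⁻¹ (b⁻¹ (mk [])) = c⁻¹ (b⁻¹ (mk [])) := σ_inv_zero_σ_inv_one_mk_nil
    rw [h1]
    simp
  · fin_cases i
    exacts [ha1 q h, hb1 q h, hc1 q h]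
  · fin_cases i
    exacts [ha2 q h, hb2 q h, hc2 q h]

/-- A twist of the two right ends of a rational tangle can be flyped to the two left ends. -/
theorem σ_two_eq : σ 2 = σ 0 := by
  ext1 q
  have := (isFlypeInvariant (σ 0 q)).1
  simpa using this

/-- A full twist of three ends acts trivially on rational tangles. -/
theorem σ_fullTwist : σ 0 * σ 1 * σ 0 * (σ 0 * σ 1 * σ 0) = 1 := by
  have hab := σ_braid_zero_one
  set a := σ 0 with ha
  set b := σ 1 with hb
  obtain ⟨h1, h2⟩ := commute_halfTwist_sq hab
  set z := a * b * a * (a * b * a) with hz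
  have key : ∀ {f : Equiv.Perm Tangle} {q}, Commute z f → z q = q → z (f q) = f q := by
    intro f q h h'
    rw [← Equiv.Perm.mul_apply, h.eq, Equiv.Perm.mul_apply, h']
  have h3 : Commute z (σ 2) := by rw [σ_two_eq]; exact h1
  ext1 q
  rw [Equiv.Perm.one_apply]
  refine induction_on q ?_ (fun i q h => ?_) fun i q h => ?_
  · have h4 : b (a (a (b (mk [])))) = mk [] := by
      have := σ_swap_mk_nil
      rwa [σ_two_eq] at this
    have h5 : a (mk []) = mk [] := σ_zero_mk_nil
    simp only [hz, Equiv.Perm.mul_apply, h5, h4]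
  · fin_cases i
    exacts [key h1 h, key h2 h, key h3 h]
  · fin_cases i
    exacts [key h1.inv_right h, key h2.inv_right h, key h3.inv_right h]

/-! ### Normal form of rational tangles -/

/-- The braid word with the full twists of the middle pair of strands (`true`) or of the
pair at position `i` (`false`) that are listed by `e`, together with their signs. -/
def _root_.S3Link.BraidWord.twists (i : Fin 3) (e : List (Bool × Bool)) : BraidWord :=
  e.flatMap fun p => [(if p.1 then 1 else i, p.2), (if p.1 then 1 else i, p.2)]

end Tangle

open BraidWord

namespace Tangle

theorem mk_twists_zero_eq_two (e : List (Bool × Bool)) : mk (twists 0 e) = mk (twists 2 e) := by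
  induction e using List.reverseRecOn with
  | nil => rfl
  | append_singleton e p ih =>
    have key : ∀ i : Fin 3, mk (twists i (e ++ [p])) =
        mk ((twists i e ++ [(if p.1 then 1 else i, p.2)]) ++ [(if p.1 then 1 else i, p.2)]) := by
      intro i; simp [twists]
    rw [key, key]
    obtain ⟨_ | _, _ | _⟩ := p <;>
      simp only [mk_append_true, mk_append_false, ih, σ_two_eq, if_true, Bool.false_eq_true,
        if_false]

/-- The rational tangles that are made of full twists. -/
def IsTwisted (q : Tangle) : Prop := ∃ e, q = mk (twists 0 e)

theorem IsTwisted.exists_add {q : Tangle} (h : IsTwisted q) :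
    IsTwisted (σ 0 (σ 0 q)) ∧ IsTwisted ((σ 0)⁻¹ ((σ 0)⁻¹ q)) ∧
      IsTwisted (σ 1 (σ 1 q)) ∧ IsTwisted ((σ 1)⁻¹ ((σ 1)⁻¹ q)) := by
  obtain ⟨e, rfl⟩ := h
  have key : ∀ p : Bool × Bool, mk (twists 0 (e ++ [p])) =
      mk ((twists 0 e ++ [(if p.1 then 1 else 0, p.2)]) ++ [(if p.1 then 1 else 0, p.2)]) := by
    intro i; simp [twists]
  exact ⟨⟨e ++ [(false, true)], (key (false, true)).symm⟩,
    ⟨e ++ [(false, false)], (key (false, false)).symm⟩,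
    ⟨e ++ [(true, true)], (key (true, true)).symm⟩,
    ⟨e ++ [(true, false)], (key (true, false)).symm⟩⟩

/-- The braid words that represent the cosets of the subgroup generated by the squares
of the first two generators. -/
def cosetWords : List BraidWord :=
  [[], [(0, true)], [(1, true)], [(1, true), (0, true)], [(0, true), (1, true)],
    [(0, true), (1, true), (0, true)]]

/-- Every rational tangle is made of full twists of two neighboring pairs of strands, followed by
one of six short words: as the full twist of three strands acts trivially, the generators act
as those of the modular group, in which their squares generate a subgroup of index six. -/
theorem exists_normalForm (q : Tangle) :
    ∃ e, ∃ r ∈ cosetWords, q = mk (twists 0 e ++ r) := by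
  have hab := σ_braid_zero_one
  have hz := σ_fullTwist
  set a := σ 0 with ha
  set b := σ 1 with hb
  -- A generator times a coset word is a coset word times a product of squares.
  have k1 : a * (a * b) = b * (b⁻¹ * (b⁻¹ * (a⁻¹ * a⁻¹))) := by
    have : a * (a * b) = b⁻¹ * a⁻¹ * (a * b * a * (a * b * a)) * a⁻¹ := by group
    rw [this, hz]; group
  have k2 : b * (b * a) = a * (a⁻¹ * (a⁻¹ * (b⁻¹ * b⁻¹))) := by
    have : b * (b * a) = a⁻¹ * b⁻¹ * (b * a * b * (b * a * b)) * b⁻¹ := by group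
    rw [this, ← hab, hz]; group
  have k3 : a * (a * (b * a)) = b * (a * (b * b)) := by
    have : b * (a * (b * b)) = b * a * b * b := by group
    rw [this, ← hab, mul_assoc a, mul_assoc a, mul_assoc b, ← mul_assoc b, ← hab]; group
  have k4 : b * (a * (b * a)) = a * (b * (a * a)) := by
    have : b * (a * (b * a)) = b * a * b * a := by group
    rw [this, ← hab]; group
  have k5 : a⁻¹ * b = a * (b * (a * (a * (b * b)))) := by
    have : a * (b * (a * (a * (b * b)))) = a * b * (a * (a * b)) * b := by group
    rw [this, k1]; group
  have k6 : b⁻¹ * a = b * (a * (b * (b * (a * a)))) := by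
    have : b * (a * (b * (b * (a * a)))) = b * a * (b * (b * a)) * a := by group
    rw [this, k2]; group
  have k7 : a⁻¹ * (b * a) = a * (b * (a * (b⁻¹ * b⁻¹))) := by
    have : a * (b * (a * (b⁻¹ * b⁻¹))) = a * b * a * b⁻¹ * b⁻¹ := by group
    rw [this, hab, inv_mul_eq_iff_eq_mul]
    have : a * (b * a * b * b⁻¹ * b⁻¹) = a * b * a * b⁻¹ := by group
    rw [this, hab]; group
  have k8 : b⁻¹ * (a * b) = a * (b * (a * (a⁻¹ * a⁻¹))) := by
    have : a * (b * (a * (a⁻¹ * a⁻¹))) = a * b * a⁻¹ := by group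
    rw [this, ← inv_mul_mul_of_braid hab, mul_assoc]
  have k9 : b⁻¹ * (a * (b * a)) = a * b := by
    rw [inv_mul_eq_iff_eq_mul, ← mul_assoc, hab, mul_assoc]
  let N : Tangle → Prop := fun q => ∃ x, IsTwisted x ∧
    (q = x ∨ q = a x ∨ q = b x ∨ q = a (b x) ∨ q = b (a x) ∨ q = a (b (a x)))
  have hN : ∀ q, N q → N (a q) ∧ N (a⁻¹ q) ∧ N (b q) ∧ N (b⁻¹ q) := by
    rintro q ⟨x, hx, hq⟩
    obtain ⟨t1, t2, t3, t4⟩ := hx.exists_add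
    have inv_app : ∀ (f : Equiv.Perm Tangle) q, f⁻¹ (f q) = q := fun f q => by simp
    rcases hq with rfl | rfl | rfl | rfl | rfl | rfl
    · refine ⟨⟨q, hx, ?_⟩, ⟨_, t2, .inr (.inl ?_)⟩, ⟨q, hx, ?_⟩, ⟨_, t4, .inr (.inr (.inl ?_))⟩⟩
      · simp
      · exact (a.apply_symm_apply (a⁻¹ q)).symm
      · simp
      · exact (b.apply_symm_apply (b⁻¹ q)).symm
    · refine ⟨⟨_, t1, .inl rfl⟩, ⟨x, hx, .inl (inv_app _ _)⟩, ⟨x, hx, ?_⟩,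
        ⟨_, (IsTwisted.exists_add t1).2.2.1, ?_⟩⟩
      · simp
      · right; right; right; right; left
        exact DFunLike.congr_fun k6 x
    · refine ⟨⟨x, hx, ?_⟩, ⟨_, (IsTwisted.exists_add t3).1, ?_⟩, ⟨_, t3, .inl rfl⟩,
        ⟨x, hx, .inl (inv_app _ _)⟩⟩
      · simp
      · right; right; right; left
        exact DFunLike.congr_fun k5 x
    · refine ⟨⟨_, (IsTwisted.exists_add t2).2.2.2, .inr (.inr (.inl ?_))⟩,
        ⟨x, hx, .inr (.inr (.inl (inv_app _ _)))⟩, ⟨x, hx, ?_⟩, ⟨_, t2, ?_⟩⟩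
      · exact DFunLike.congr_fun k1 x
      · right; right; right; right; right
        exact DFunLike.congr_fun hab.symm x
      · right; right; right; right; right
        exact DFunLike.congr_fun k8 x
    · refine ⟨⟨x, hx, ?_⟩, ⟨_, t4, ?_⟩, ⟨_, (IsTwisted.exists_add t4).2.1, .inr (.inl ?_)⟩,
        ⟨x, hx, .inr (.inl (inv_app _ _))⟩⟩
      · simp
      · right; right; right; right; right
        exact DFunLike.congr_fun k7 x
      · exact DFunLike.congr_fun k2 x
    · refine ⟨⟨_, t3, ?_⟩, ⟨x, hx, ?_⟩, ⟨_, t1, ?_⟩, ⟨x, hx, ?_⟩⟩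
      · right; right; right; right; left
        exact DFunLike.congr_fun k3 x
      · right; right; right; right; left
        exact inv_app _ _
      · right; right; right; left
        exact DFunLike.congr_fun k4 x
      · right; right; right; left
        exact DFunLike.congr_fun k9 x
  have h : N q := by
    refine induction_on q ⟨mk [], ⟨[], rfl⟩, .inl rfl⟩ (fun i q h => ?_) fun i q h => ?_
    · fin_cases i
      · exact (hN q h).1
      · exact (hN q h).2.2.1
      · change N (σ 2 q)
        rw [σ_two_eq]
        exact (hN q h).1
    · fin_cases i
      · exact (hN q h).2.1
      · exact (hN q h).2.2.2
      · change N ((σ 2)⁻¹ q)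
        rw [σ_two_eq]
        exact (hN q h).2.1
  obtain ⟨x, ⟨e, rfl⟩, h⟩ := h
  rcases h with h | h | h | h | h | h
  · exact ⟨e, [], by simp [cosetWords], by simpa using h⟩
  · exact ⟨e, [(0, true)], by simp [cosetWords], h⟩
  · exact ⟨e, [(1, true)], by simp [cosetWords], h⟩
  · refine ⟨e, [(1, true), (0, true)], by simp [cosetWords], h.trans ?_⟩
    change mk ((_ ++ [(1, true)]) ++ [(0, true)]) = _
    simp
  · refine ⟨e, [(0, true), (1, true)], by simp [cosetWords], h.trans ?_⟩
    change mk ((_ ++ [(0, true)]) ++ [(1, true)]) = _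
    simp
  · refine ⟨e, [(0, true), (1, true), (0, true)], by simp [cosetWords], h.trans ?_⟩
    change mk (((_ ++ [(0, true)]) ++ [(1, true)]) ++ [(0, true)]) = _
    simp

end Tangle

/-! ### Signed colors and their propagation through a word -/

/-- `t` arises from `s` by replacing the block `m` with `a` entries on its left by `m'`. -/
def Splice {α : Type*} (a : ℕ) (m m' s t : List α) : Prop :=
  ∃ l r, l.length = a ∧ s = l ++ m ++ r ∧ t = l ++ m' ++ r

theorem splice_zero {α : Type*} {m m' s t : List α} :
    Splice 0 m m' s t ↔ ∃ r, s = m ++ r ∧ t = m' ++ r := by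
  simp [Splice, List.length_eq_zero_iff]

theorem splice_succ {α : Type*} {a : ℕ} {m m' s t : List α} :
    Splice (a + 1) m m' s t ↔ ∃ x s' t', s = x :: s' ∧ t = x :: t' ∧ Splice a m m' s' t' := by
  constructor
  · rintro ⟨l, r, hl, rfl, rfl⟩
    obtain ⟨x, l, rfl⟩ := List.exists_cons_of_length_eq_add_one hl
    exact ⟨x, _, _, rfl, rfl, l, r, by simpa using hl, rfl, rfl⟩
  · rintro ⟨x, _, _, rfl, rfl, l, r, rfl, rfl, rfl⟩
    exact ⟨x :: l, r, rfl, rfl, rfl⟩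

/-- The signed color of a strand is its color if the strand is directed upward, and the inverse
of its color otherwise. `c.Tr m m'` says that `m` and `m'` can be the signed colors below and above
a piece of kind `c`; this does not depend on the directions of the strands. -/
inductive Kind.Tr : Kind → List S3 → List S3 → Prop
  | cup (o : Bool) (g : S3) (hg : g ≠ 1) : Tr (.cup o) [] [g, g⁻¹]
  | cap (g : S3) : Tr .cap [g, g⁻¹] []
  | crossOver (x y : S3) : Tr (.cross true) [x, y] [x * y * x⁻¹, x]
  | crossUnder (x y : S3) : Tr (.cross false) [x, y] [y, y⁻¹ * x * y]

/-- `s` and `t` can be the signed colors below and above the layer `P`. -/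
def CStep (P : Layer) (s t : List S3) : Prop :=
  ∃ m m', P.kind.Tr m m' ∧ Splice P.pos m m' s t

theorem cstep_succ {c : Kind} {a : ℕ} {s t : List S3} :
    CStep ⟨c, a + 1⟩ s t ↔ ∃ x s' t', s = x :: s' ∧ t = x :: t' ∧ CStep ⟨c, a⟩ s' t' := by
  simp only [CStep, splice_succ]
  constructor
  · rintro ⟨m, m', h, x, s', t', rfl, rfl, h'⟩
    exact ⟨x, s', t', rfl, rfl, m, m', h, h'⟩
  · rintro ⟨x, s', t', rfl, rfl, m, m', h, h'⟩
    exact ⟨m, m', h, x, s', t', rfl, rfl, h'⟩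

@[simp] theorem cstep_succ_cons {c : Kind} {a : ℕ} {x : S3} {s t : List S3} :
    CStep ⟨c, a + 1⟩ (x :: s) t ↔ ∃ t', t = x :: t' ∧ CStep ⟨c, a⟩ s t' := by
  rw [cstep_succ]
  constructor
  · rintro ⟨_, _, t', h, rfl, h'⟩
    obtain ⟨rfl, rfl⟩ := List.cons.inj h
    exact ⟨t', rfl, h'⟩
  · rintro ⟨t', rfl, h⟩
    exact ⟨x, s, t', rfl, rfl, h⟩

@[simp] theorem cstep_succ_nil {c : Kind} {a : ℕ} {t : List S3} :
    ¬ CStep ⟨c, a + 1⟩ [] t := by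
  simp [cstep_succ]

@[simp] theorem cstep_cup_zero {o : Bool} {s t : List S3} :
    CStep ⟨.cup o, 0⟩ s t ↔ ∃ g, g ≠ 1 ∧ t = g :: g⁻¹ :: s := by
  simp only [CStep, splice_zero]
  constructor
  · rintro ⟨_, _, ⟨⟩, r, rfl, rfl⟩
    exact ⟨_, ‹_›, rfl⟩
  · rintro ⟨g, hg, rfl⟩
    exact ⟨_, _, .cup o g hg, s, rfl, rfl⟩

@[simp] theorem cstep_cap_zero {s t : List S3} :
    CStep ⟨.cap, 0⟩ s t ↔ ∃ g, s = g :: g⁻¹ :: t := by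
  simp only [CStep, splice_zero]
  constructor
  · rintro ⟨_, _, ⟨⟩, r, rfl, rfl⟩
    exact ⟨_, rfl⟩
  · rintro ⟨g, rfl⟩
    exact ⟨_, _, .cap g, t, rfl, rfl⟩

/-- The signed colors above a crossing. -/
def crossColors : Bool → S3 → S3 → List S3
  | true, x, y => [x * y * x⁻¹, x]
  | false, x, y => [y, y⁻¹ * x * y]

@[simp] theorem crossColors_true (x y : S3) : crossColors true x y = [x * y * x⁻¹, x] := rfl

@[simp] theorem crossColors_false (x y : S3) : crossColors false x y = [y, y⁻¹ * x * y] := rfl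

theorem cstep_cross_zero {b : Bool} {s t : List S3} :
    CStep ⟨.cross b, 0⟩ s t ↔ ∃ x y r, s = x :: y :: r ∧ t = crossColors b x y ++ r := by
  simp only [CStep, splice_zero]
  constructor
  · rintro ⟨_, _, ⟨⟩, r, rfl, rfl⟩ <;> exact ⟨_, _, r, rfl, rfl⟩
  · rintro ⟨x, y, r, rfl, rfl⟩
    cases b
    · exact ⟨_, _, .crossUnder x y, r, rfl, rfl⟩
    · exact ⟨_, _, .crossOver x y, r, rfl, rfl⟩

@[simp] theorem cstep_cross_zero_cons {b : Bool} {x y : S3} {s t : List S3} :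
    CStep ⟨.cross b, 0⟩ (x :: y :: s) t ↔ t = crossColors b x y ++ s := by
  rw [cstep_cross_zero]
  constructor
  · rintro ⟨_, _, _, h, rfl⟩
    simp only [List.cons.injEq] at h
    obtain ⟨rfl, rfl, rfl⟩ := h
    rfl
  · rintro rfl
    exact ⟨x, y, s, rfl, rfl⟩

@[simp] theorem cstep_cross_zero_singleton {b : Bool} {x : S3} {t : List S3} :
    ¬ CStep ⟨.cross b, 0⟩ [x] t := by
  simp [cstep_cross_zero]

@[simp] theorem cstep_cross_zero_nil {b : Bool} {t : List S3} :
    ¬ CStep ⟨.cross b, 0⟩ [] t := by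
  simp [cstep_cross_zero]

/-- The set of signs of the permutations in a list. -/
def signs (s : List S3) : Set ℤˣ := {ε | ∃ g ∈ s, Equiv.Perm.sign g = ε}

@[simp] theorem signs_nil : signs [] = ∅ := by simp [signs]

@[simp] theorem signs_cons (g : S3) (s : List S3) :
    signs (g :: s) = insert (Equiv.Perm.sign g) (signs s) := by
  ext ε
  simp [signs, eq_comm]

/-- `Col w s t E`: there are signed colors on all horizontal lines of the word `w` that are
compatible with its layers, are `s` at the bottom and `t` at the top, and whose signs
are the elements of `E`. -/
def Col : List Layer → List S3 → List S3 → Set ℤˣ → Prop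
  | [], s, t, E => s = t ∧ E = signs s
  | P :: w, s, t, E => ∃ m E', CStep P s m ∧ Col w m t E' ∧ E = signs s ∪ E'

@[simp] theorem col_nil {s t : List S3} {E : Set ℤˣ} : Col [] s t E ↔ s = t ∧ E = signs s := Iff.rfl

@[simp] theorem col_cons {P : Layer} {w : List Layer} {s t : List S3} {E : Set ℤˣ} :
    Col (P :: w) s t E ↔ ∃ m E', CStep P s m ∧ Col w m t E' ∧ E = signs s ∪ E' := Iff.rfl

theorem Col.signs_subset {w : List Layer} {s t : List S3} {E : Set ℤˣ} (h : Col w s t E) :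
    signs s ⊆ E := by
  cases w with
  | nil => rw [h.2]
  | cons P w =>
    obtain ⟨m, E', -, -, rfl⟩ := h
    exact Set.subset_union_left

theorem col_append {u v : List Layer} {s t : List S3} {E : Set ℤˣ} :
    Col (u ++ v) s t E ↔ ∃ m E₁ E₂, Col u s m E₁ ∧ Col v m t E₂ ∧ E = E₁ ∪ E₂ := by
  induction u generalizing s E with
  | nil =>
    constructor
    · intro h
      exact ⟨s, _, E, ⟨rfl, rfl⟩, h, (Set.union_eq_self_of_subset_left h.signs_subset).symm⟩
    · rintro ⟨_, _, E, ⟨rfl, rfl⟩, h, rfl⟩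
      rwa [Set.union_eq_self_of_subset_left h.signs_subset]
  | cons P u ih =>
    simp only [List.cons_append, col_cons, ih]
    constructor
    · rintro ⟨m, _, h, ⟨m', E₁, E₂, h1, h2, rfl⟩, rfl⟩
      exact ⟨m', _, E₂, ⟨m, E₁, h, h1, rfl⟩, h2, (Set.union_assoc _ _ _).symm⟩
    · rintro ⟨m', _, E₂, ⟨m, E₁, h, h1, rfl⟩, h2, rfl⟩
      exact ⟨m, _, h, ⟨m', E₁, E₂, h1, h2, rfl⟩, Set.union_assoc _ _ _⟩

theorem length_of_cstep {P : Layer} {s t : List S3} (h : CStep P s t) :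
    t.length + P.kind.inputs = s.length + P.kind.outputs := by
  obtain ⟨c, a⟩ := P
  obtain ⟨m, m', h, l, r, hl, rfl, rfl⟩ := h
  cases h <;> simp [Kind.inputs, Kind.outputs] <;> omega

theorem Col.length_eq {w : List Layer} {s t : List S3} {E : Set ℤˣ} (h : Col w s t E)
    {d d' : List Bool} (hd : s.length = d.length) (hr : run w d = some d') :
    t.length = d'.length := by
  induction w generalizing s E d with
  | nil =>
    obtain ⟨rfl, -⟩ := h
    obtain rfl : d = d' := by simpa using hr
    exact hd
  | cons P w ih =>
    obtain ⟨m, E', hm, h, -⟩ := h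
    obtain ⟨e, he, hr⟩ := Option.bind_eq_some_iff.1 hr
    refine ih h ?_ hr
    have h1 := length_of_cstep hm
    have h2 := length_of_step P he
    omega

theorem col_shift_one {w : List Layer} {x : S3} {s t : List S3} {E : Set ℤˣ} :
    Col (w.map (Layer.shift 1)) (x :: s) t E ↔
      ∃ t' E', t = x :: t' ∧ E = insert (Equiv.Perm.sign x) E' ∧ Col w s t' E' := by
  induction w generalizing s E with
  | nil =>
    simp only [List.map_nil, col_nil, signs_cons]
    constructor
    · rintro ⟨rfl, rfl⟩
      exact ⟨s, _, rfl, rfl, rfl, rfl⟩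
    · rintro ⟨t', _, rfl, rfl, rfl, rfl⟩
      exact ⟨rfl, rfl⟩
  | cons P w ih =>
    obtain ⟨c, a⟩ := P
    simp only [List.map_cons, Layer.shift_mk, col_cons, Nat.add_comm 1 a, cstep_succ_cons,
      signs_cons]
    constructor
    · rintro ⟨_, E', ⟨m, rfl, hm⟩, h, rfl⟩
      obtain ⟨t', E', rfl, rfl, h'⟩ := ih.1 h
      exact ⟨t', _, rfl, by rw [← Set.insert_union_distrib], m, E', hm, h', rfl⟩
    · rintro ⟨t', _, rfl, rfl, m, E', hm, h, rfl⟩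
      exact ⟨x :: m, _, ⟨m, rfl, hm⟩, ih.2 ⟨t', E', rfl, rfl, h⟩, by
        rw [← Set.insert_union_distrib]⟩

/-- None of the signed colors is trivial. -/
def IsNontrivial (s : List S3) : Prop := ∀ g ∈ s, g ≠ 1

theorem IsNontrivial.of_cstep {P : Layer} {s t : List S3} (hs : IsNontrivial s)
    (h : CStep P s t) : IsNontrivial t := by
  obtain ⟨c, a⟩ := P
  obtain ⟨m, m', h, l, r, hl, rfl, rfl⟩ := h
  have h1 : ∀ {x y : S3}, x ≠ 1 → y⁻¹ * x * y ≠ 1 := fun {x y} hx h => hx (by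
    rwa [mul_assoc, inv_mul_eq_one, eq_comm, mul_eq_right] at h)
  cases h <;> simp only [IsNontrivial, List.mem_append, List.mem_cons] at hs ⊢ <;> intro g hg
  · rcases hg with (hg | hg) | hg
    · exact hs g (by simp [hg])
    · rcases hg with rfl | rfl | hg
      · assumption
      · simpa
      · simp at hg
    · exact hs g (by simp [hg])
  · rcases hg with (hg | hg) | hg
    · exact hs g (by simp [hg])
    · simp at hg
    · exact hs g (by simp [hg])
  · rcases hg with (hg | hg) | hg
    · exact hs g (by simp [hg])
    · rcases hg with rfl | rfl | hg
      · simpa using hs _ (.inl (.inr (.inr (.inl rfl))))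
      · exact hs _ (by simp)
      · simp at hg
    · exact hs g (by simp [hg])
  · rcases hg with (hg | hg) | hg
    · exact hs g (by simp [hg])
    · rcases hg with rfl | rfl | hg
      · exact hs _ (by simp)
      · exact h1 (hs _ (.inl (.inr (.inl rfl))))
      · simp at hg
    · exact hs g (by simp [hg])

theorem IsNontrivial.of_col {w : List Layer} {s t : List S3} {E : Set ℤˣ} (hs : IsNontrivial s)
    (h : Col w s t E) : IsNontrivial t := by
  induction w generalizing s E with
  | nil => exact h.1 ▸ hs
  | cons P w ih =>
    obtain ⟨m, E', hm, h, -⟩ := h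
    exact ih (hs.of_cstep hm) h

theorem col_shift_congr {l r : List Layer} {k : ℕ}
    (h : ∀ s, k ≤ s.length → IsNontrivial s → ∀ t E, Col l s t E ↔ Col r s t E) (n : ℕ)
    (s : List S3) (hs : n + k ≤ s.length) (hn : IsNontrivial s) (t : List S3) (E : Set ℤˣ) :
    Col (l.map (Layer.shift n)) s t E ↔ Col (r.map (Layer.shift n)) s t E := by
  induction n generalizing s t E with
  | zero => simpa [Layer.shift_zero] using h s (by simpa using hs) hn t E
  | succ n ih =>
    rw [map_shift_succ n l, map_shift_succ n r]
    cases s with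
    | nil => simp at hs
    | cons x s =>
      have := ih s (by simp only [List.length_cons] at hs; omega)
        fun g hg => hn g (List.mem_cons_of_mem _ hg)
      simp only [col_shift_one, this]

theorem pos_le_of_step {P : Layer} {s t : List Bool} (h : P.step s = some t) :
    P.pos + P.kind.inputs ≤ s.length := by
  obtain ⟨c, a⟩ := P
  cases c with
  | cup o =>
    simp only [Layer.step] at h
    split_ifs at h with h'
    simpa [Kind.inputs] using h'
  | cap =>
    simp only [Layer.step] at h
    split at h
    · rename_i h'
      have := congrArg List.length h'
      simp [Kind.inputs] at this ⊢
      omega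
    · simp at h
  | cross b => exact (step_isSome_iff_of_cross b a s).1 ⟨t, h⟩

theorem col_exchange (c d : Kind) (n : ℕ) (s t : List S3) (E : Set ℤˣ) :
    Col [⟨c, d.inputs + n⟩, ⟨d, 0⟩] s t E ↔ Col [⟨d, 0⟩, ⟨c, d.outputs + n⟩] s t E := by
  cases d with
  | cup o =>
    simp only [Kind.inputs, Kind.outputs, Nat.zero_add, Nat.add_comm 2 n, col_cons, col_nil]
    constructor
    · rintro ⟨m, _, h, ⟨_, _, h', ⟨rfl, rfl⟩, rfl⟩, rfl⟩
      obtain ⟨g, hg, rfl⟩ := cstep_cup_zero.1 h'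
      refine ⟨g :: g⁻¹ :: s, _, by simpa using hg,
        ⟨g :: g⁻¹ :: m, _, by simpa, ⟨rfl, rfl⟩, rfl⟩, ?_⟩
      ext ε; simp; tauto
    · rintro ⟨_, _, h, ⟨_, _, h', ⟨rfl, rfl⟩, rfl⟩, rfl⟩
      obtain ⟨g, hg, rfl⟩ := cstep_cup_zero.1 h
      simp only [cstep_succ_cons] at h'
      obtain ⟨_, rfl, m, rfl, h'⟩ := h'
      refine ⟨m, _, h', ⟨g :: g⁻¹ :: m, _, by simpa using hg, ⟨rfl, rfl⟩, rfl⟩, ?_⟩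
      ext ε; simp; tauto
  | cap =>
    simp only [Kind.inputs, Kind.outputs, Nat.zero_add, Nat.add_comm 2 n, col_cons, col_nil]
    constructor
    · rintro ⟨m, _, h, ⟨_, _, h', ⟨rfl, rfl⟩, rfl⟩, rfl⟩
      obtain ⟨g, rfl⟩ := cstep_cap_zero.1 h'
      obtain ⟨_, _, _, rfl, h1, h⟩ := cstep_succ.1 h
      obtain ⟨rfl, rfl⟩ := List.cons.inj h1
      obtain ⟨_, s, _, rfl, h1, h⟩ := cstep_succ.1 h
      obtain ⟨rfl, rfl⟩ := List.cons.inj h1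
      refine ⟨s, _, by simp, ⟨_, _, h, ⟨rfl, rfl⟩, rfl⟩, ?_⟩
      ext ε; simp; tauto
    · rintro ⟨m, _, h, ⟨t, _, h', ⟨h1, rfl⟩, rfl⟩, rfl⟩
      obtain ⟨g, rfl⟩ := cstep_cap_zero.1 h
      rw [← h1]
      refine ⟨g :: g⁻¹ :: t, _, by simpa using h', ⟨_, _, by simp, ⟨rfl, rfl⟩, rfl⟩, ?_⟩
      ext ε; simp; tauto
  | cross b =>
    simp only [Kind.inputs, Kind.outputs, Nat.add_comm 2 n, col_cons, col_nil]
    constructor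
    · rintro ⟨m, _, h, ⟨_, _, h', ⟨rfl, rfl⟩, rfl⟩, rfl⟩
      obtain ⟨x, y, m, rfl, rfl⟩ := cstep_cross_zero.1 h'
      obtain ⟨_, _, _, rfl, h1, h⟩ := cstep_succ.1 h
      obtain ⟨rfl, rfl⟩ := List.cons.inj h1
      obtain ⟨_, s, _, rfl, h1, h⟩ := cstep_succ.1 h
      obtain ⟨rfl, rfl⟩ := List.cons.inj h1
      refine ⟨_, _, cstep_cross_zero_cons.2 rfl,
        ⟨crossColors b _ _ ++ m, _, ?_, ⟨rfl, rfl⟩, rfl⟩, ?_⟩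
      · cases b <;> simpa using h
      · cases b <;> · ext ε; simp; tauto
    · rintro ⟨m, _, h, ⟨t', _, h', ⟨ht, rfl⟩, rfl⟩, rfl⟩
      rw [← ht]
      clear ht t
      rename' t' => t
      obtain ⟨x, y, s, rfl, rfl⟩ := cstep_cross_zero.1 h
      have h' : ∃ m, CStep ⟨c, n⟩ s m ∧ t = crossColors b x y ++ m := by
        cases b
        · simp only [crossColors_false, List.cons_append, List.nil_append, cstep_succ_cons] at h'
          obtain ⟨_, rfl, m, rfl, h'⟩ := h'
          exact ⟨m, h', rfl⟩
        · simp only [crossColors_true, List.cons_append, List.nil_append, cstep_succ_cons] at h'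
          obtain ⟨_, rfl, m, rfl, h'⟩ := h'
          exact ⟨m, h', rfl⟩
      obtain ⟨m, hm, rfl⟩ := h'
      refine ⟨x :: y :: m, _, ?_, ⟨_, _, cstep_cross_zero_cons.2 rfl, ⟨rfl, rfl⟩, rfl⟩, ?_⟩
      · simpa using hm
      · cases b <;> · ext ε; simp; tauto

theorem units_mul_self_mul (p q : ℤˣ) : p * (p * q) = q := by
  rw [← mul_assoc, Int.units_mul_self, one_mul]

theorem col_slideCup (o b : Bool) (s t : List S3) (E : Set ℤˣ) :
    Col [⟨.cup o, 0⟩, ⟨.cross b, 1⟩] s t E ↔ Col [⟨.cup o, 1⟩, ⟨.cross (!b), 0⟩] s t E := by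
  rcases s with _ | ⟨x, s⟩
  · simp
  · cases b
    · simp
      constructor
      · rintro ⟨g, hg, rfl, rfl⟩
        refine ⟨x⁻¹ * g * x, fun h => hg ?_, by simp [mul_assoc], ?_⟩
        · rwa [mul_assoc, inv_mul_eq_one, eq_comm, mul_eq_right] at h
        · ext ε; simp [mul_assoc, mul_comm, units_mul_self_mul]; tauto
      · rintro ⟨g, hg, rfl, rfl⟩
        refine ⟨x * g * x⁻¹, by simpa using hg, by simp [mul_assoc], ?_⟩
        ext ε; simp [mul_assoc, mul_comm, units_mul_self_mul]; tauto
    · simp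
      refine exists_congr fun g => and_congr_right fun _ => and_congr_right fun _ => ?_
      rw [Set.insert_comm (Equiv.Perm.sign x) (Equiv.Perm.sign g)]

theorem col_slideCap (b : Bool) (s t : List S3) (E : Set ℤˣ) :
    Col [⟨.cross b, 1⟩, ⟨.cap, 0⟩] s t E ↔ Col [⟨.cross (!b), 0⟩, ⟨.cap, 1⟩] s t E := by
  rcases s with _ | ⟨x, _ | ⟨y, _ | ⟨z, s⟩⟩⟩
  · simp
  · simp
  · cases b <;> simp
  · cases b <;> simp [mul_assoc, mul_left_comm, mul_comm, units_mul_self_mul]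
    · constructor
      · rintro ⟨⟨rfl, rfl⟩, rfl⟩
        refine ⟨⟨by simp, rfl⟩, ?_⟩
        ext ε; simp; tauto
      · rintro ⟨⟨rfl, rfl⟩, rfl⟩
        refine ⟨⟨rfl, by simp⟩, ?_⟩
        ext ε; simp; tauto
    · constructor
      · rintro ⟨⟨h, rfl⟩, rfl⟩
        refine ⟨⟨rfl, ?_⟩, ?_⟩
        · rw [← h]; group
        · ext ε; simp; tauto
      · rintro ⟨⟨rfl, rfl⟩, rfl⟩
        refine ⟨⟨by group, rfl⟩, ?_⟩
        ext ε; simp; tauto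

theorem col_reidemeisterOneCup (o b : Bool) (s t : List S3) (E : Set ℤˣ) :
    Col [⟨.cup o, 0⟩, ⟨.cross b, 0⟩] s t E ↔ Col [⟨.cup (!o), 0⟩] s t E := by
  cases b
  all_goals
    simp only [col_cons, col_nil, cstep_cup_zero]
    constructor
    · rintro ⟨_, _, ⟨g, hg, rfl⟩, ⟨m, _, h, ⟨rfl, rfl⟩, rfl⟩, rfl⟩
      obtain rfl := cstep_cross_zero_cons.1 h
      refine ⟨_, _, ⟨g⁻¹, by simpa using hg, rfl⟩, ⟨by simp, rfl⟩, ?_⟩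
      ext ε; simp
    · rintro ⟨_, _, ⟨g, hg, rfl⟩, ⟨rfl, rfl⟩, rfl⟩
      refine ⟨_, _, ⟨g⁻¹, by simpa using hg, rfl⟩, ⟨_, _, cstep_cross_zero_cons.2 rfl,
        ⟨by simp, rfl⟩, rfl⟩, ?_⟩
      ext ε; simp

theorem col_reidemeisterOneCap (b : Bool) (s t : List S3) (E : Set ℤˣ) :
    Col [⟨.cross b, 0⟩, ⟨.cap, 0⟩] s t E ↔ Col [⟨.cap, 0⟩] s t E := by
  rcases s with _ | ⟨x, _ | ⟨y, s⟩⟩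
  · simp
  · simp
  · cases b <;> simp [mul_assoc, mul_left_comm, mul_comm, units_mul_self_mul]
    all_goals
      constructor
      · rintro ⟨⟨h, rfl⟩, rfl⟩
        refine ⟨?_, rfl, ?_⟩
        · first
            | exact eq_inv_of_mul_eq_one_right h
            | rw [← mul_inv_rev, inv_eq_one] at h
              exact eq_inv_of_mul_eq_one_right h
        · ext ε; simp; tauto
      · rintro ⟨rfl, rfl, rfl⟩
        refine ⟨⟨by simp, rfl⟩, ?_⟩
        ext ε; simp

theorem col_reidemeisterThree (b₁ b₂ b₃ : Bool) (h : b₁ = b₂ ∨ b₂ = b₃) (s t : List S3)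
    (E : Set ℤˣ) :
    Col [⟨.cross b₁, 0⟩, ⟨.cross b₂, 1⟩, ⟨.cross b₃, 0⟩] s t E ↔
      Col [⟨.cross b₃, 1⟩, ⟨.cross b₂, 0⟩, ⟨.cross b₁, 1⟩] s t E := by
  rcases s with _ | ⟨x, _ | ⟨y, _ | ⟨z, s⟩⟩⟩
  · simp
  · simp
  · cases b₁ <;> cases b₂ <;> cases b₃ <;> simp at h ⊢
  · cases b₁ <;> cases b₂ <;> cases b₃ <;>
      simp [mul_assoc, mul_left_comm, mul_comm, units_mul_self_mul] at h ⊢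
    all_goals
      refine fun _ => Eq.congr_right ?_
      ext ε; simp; tauto

theorem col_reidemeisterTwo (b : Bool) {s : List S3} (h : 2 ≤ s.length) (t : List S3)
    (E : Set ℤˣ) :
    Col [⟨.cross b, 0⟩, ⟨.cross (!b), 0⟩] s t E ↔ Col [] s t E := by
  rcases s with _ | ⟨x, _ | ⟨y, s⟩⟩
  · simp at h
  · simp at h
  · cases b <;> simp [mul_assoc, mul_left_comm, mul_comm, units_mul_self_mul]
    all_goals
      rw [eq_comm (a := t)]
      refine and_congr_right fun h => Eq.congr_right ?_
      subst h
      ext ε; simp; tauto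

theorem col_zigzagLeft (o : Bool) {s : List S3} (h : 1 ≤ s.length) (hs : IsNontrivial s)
    (t : List S3) (E : Set ℤˣ) :
    Col [⟨.cup o, 1⟩, ⟨.cap, 0⟩] s t E ↔ Col [] s t E := by
  rcases s with _ | ⟨x, s⟩
  · simp at h
  · have hx : x ≠ 1 := hs x (by simp)
    simp [hx]
    refine fun h => Eq.congr_right ?_
    subst h
    simp

theorem col_zigzagRight (o : Bool) {s : List S3} (h : 1 ≤ s.length) (hs : IsNontrivial s)
    (t : List S3) (E : Set ℤˣ) :
    Col [⟨.cup o, 0⟩, ⟨.cap, 1⟩] s t E ↔ Col [] s t E := by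
  rcases s with _ | ⟨x, s⟩
  · simp at h
  · have hx : x ≠ 1 := hs x (by simp)
    simp [hx]
    rw [eq_comm (a := t)]
    refine and_congr_right fun h => Eq.congr_right ?_
    subst h
    simp

/-- Local moves do not change the possible signed colors at the ends, nor the signs that
occur. -/
theorem LocalMove.col_iff {l r : List Layer} (h : LocalMove l r) {d d' e : List Bool}
    (hl : run l d = some d') (hr : run r d = some e) {s : List S3} (hs : s.length = d.length)
    (hn : IsNontrivial s) (t : List S3) (E : Set ℤˣ) : Col l s t E ↔ Col r s t E := by
  have pos_le : ∀ {P : Layer} {w : List Layer}, l = P :: w → P.pos + P.kind.inputs ≤ s.length := by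
    rintro P w rfl
    obtain ⟨_, hP, -⟩ := Option.bind_eq_some_iff.1 hl
    exact hs ▸ pos_le_of_step hP
  have pos_le' : ∀ {P Q : Layer} {w : List Layer}, l = P :: Q :: w →
      Q.pos + Q.kind.inputs + P.kind.inputs ≤ s.length + P.kind.outputs := by
    rintro P Q w rfl
    obtain ⟨_, hP, h⟩ := Option.bind_eq_some_iff.1 hl
    obtain ⟨_, hQ, -⟩ := Option.bind_eq_some_iff.1 h
    have h1 := pos_le_of_step hQ
    have h2 := length_of_step P hP
    omega
  cases h with
  | exchange c d a n =>
    have := pos_le rfl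
    simpa [Nat.add_assoc] using
      col_shift_congr (k := 0) (fun s _ _ => col_exchange c d n s) a s (by simp at this ⊢; omega)
        hn t E
  | zigzagLeft o a =>
    have := pos_le rfl
    exact col_shift_congr (k := 1) (fun s h hn => col_zigzagLeft o h hn) a s this hn t E
  | zigzagRight o a =>
    have := pos_le' rfl
    simp only [Kind.inputs, Kind.outputs] at this
    exact col_shift_congr (k := 1) (fun s h hn => col_zigzagRight o h hn) a s (by omega) hn t E
  | slideCup o b a =>
    have := pos_le rfl
    exact col_shift_congr (k := 0) (fun s _ _ => col_slideCup o b s) a s this hn t E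
  | slideCap b a =>
    have := pos_le rfl
    exact col_shift_congr (k := 0) (fun s _ _ => col_slideCap b s) a s
      (by simp only at this; omega) hn t E
  | reidemeisterOneCup o b a =>
    have := pos_le rfl
    exact col_shift_congr (k := 0) (fun s _ _ => col_reidemeisterOneCup o b s) a s this hn t E
  | reidemeisterOneCap b a =>
    have := pos_le rfl
    exact col_shift_congr (k := 0) (fun s _ _ => col_reidemeisterOneCap b s) a s
      (by simp only at this; omega) hn t E
  | reidemeisterTwo b a =>
    have := pos_le rfl
    exact col_shift_congr (k := 2) (fun s h _ => col_reidemeisterTwo b h) a s this hn t E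
  | reidemeisterThree b₁ b₂ b₃ h a =>
    have := pos_le rfl
    exact col_shift_congr (k := 0) (fun s _ _ => col_reidemeisterThree b₁ b₂ b₃ h s) a s
      (by simp only at this; omega) hn t E

theorem LocalMove.col_context_iff {l r : List Layer} (h : LocalMove l r) (u v : List Layer)
    {d e : List Bool} (hl : run (u ++ l ++ v) [] = some d) (hr : run (u ++ r ++ v) [] = some e)
    (t : List S3) (E : Set ℤˣ) : Col (u ++ l ++ v) [] t E ↔ Col (u ++ r ++ v) [] t E := by
  rw [List.append_assoc, run_append] at hl hr
  obtain ⟨d₁, h1, hl⟩ := Option.bind_eq_some_iff.1 hl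
  obtain ⟨d₂, h2, hr⟩ := Option.bind_eq_some_iff.1 hr
  obtain rfl : d₁ = d₂ := Option.some.inj (h1.symm.trans h2)
  rw [run_append] at hl hr
  obtain ⟨_, hl, -⟩ := Option.bind_eq_some_iff.1 hl
  obtain ⟨_, hr, -⟩ := Option.bind_eq_some_iff.1 hr
  rw [List.append_assoc, List.append_assoc, col_append, col_append (u := u)]
  refine exists_congr fun m => exists_congr fun E₁ => exists_congr fun E₂ =>
    and_congr_right fun hm => and_congr_left fun _ => ?_
  rw [col_append, col_append (u := r)]
  refine exists_congr fun m' => exists_congr fun E₃ => exists_congr fun E₄ =>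
    and_congr_left fun _ => ?_
  exact h.col_iff hl hr (hm.length_eq rfl h1) (IsNontrivial.of_col (by simp [IsNontrivial]) hm) _ _

theorem Iso.col_iff {w w' : List Layer} (h : Iso w w') {d : List Bool} (hd : run w [] = some d)
    (t : List S3) (E : Set ℤˣ) : Col w [] t E ↔ Col w' [] t E := by
  induction h with
  | rel _ _ h =>
    obtain ⟨u, l, r, v, h, rfl, rfl, hr⟩ := h
    exact h.col_context_iff u v hd ((hr _).symm.trans hd) t E
  | refl _ => rfl
  | symm _ _ h ih => exact (ih ((Iso.run_eq h _).trans hd)).symm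
  | trans _ _ _ h _ ih ih' => exact (ih hd).trans (ih' ((Iso.run_eq h _).symm.trans hd))

/-- The sets of signs of the colors that occur in colorings depend only on the link. -/
theorem Diagram.col_iff_of_link_eq {D D' : Diagram}
    (h : (Quot.mk Diagram.Move D : Link) = Quot.mk Diagram.Move D') (E : Set ℤˣ) :
    Col D.word [] [] E ↔ Col D'.word [] [] E := by
  have h' := Quot.eqvGen_exact h
  clear h
  induction h' with
  | rel D D' h =>
    obtain ⟨u, l, r, v, h, h1, h2⟩ := h
    rw [h1, h2]
    exact h.col_context_iff u v (h1 ▸ D.closed) (h2 ▸ D'.closed) [] E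
  | refl _ => rfl
  | symm _ _ _ ih => exact ih.symm
  | trans _ _ _ _ _ ih ih' => exact ih.trans ih'

/-! ### Colorings of diagrams as signed colors on horizontal lines -/

theorem Splice.getElem? {α : Type*} {a : ℕ} {m m' s t : List α} (h : Splice a m m' s t) :
    (∀ j < a, s[j]? = t[j]?) ∧ (∀ j, s[a + m.length + j]? = t[a + m'.length + j]?) ∧
      (∀ i < m.length, s[a + i]? = m[i]?) ∧ ∀ i < m'.length, t[a + i]? = m'[i]? := by
  obtain ⟨l, r, rfl, rfl, rfl⟩ := h
  refine ⟨fun j hj => ?_, fun j => ?_, fun i hi => ?_, fun i hi => ?_⟩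
  · rw [List.append_assoc, List.append_assoc, List.getElem?_append_left hj,
      List.getElem?_append_left hj]
  · rw [List.getElem?_append_right (by simp), List.getElem?_append_right (by simp)]
    simp
  · rw [List.append_assoc, List.getElem?_append_right (by simp), Nat.add_sub_cancel_left,
      List.getElem?_append_left hi]
  · rw [List.append_assoc, List.getElem?_append_right (by simp), Nat.add_sub_cancel_left,
      List.getElem?_append_left hi]

theorem eq_append_of_getElem? {α : Type*} {a : ℕ} {m s : List α} (h : a + m.length ≤ s.length)
    (hm : ∀ i < m.length, s[a + i]? = m[i]?) : s = s.take a ++ m ++ s.drop (a + m.length) := by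
  refine List.ext_getElem? fun i => ?_
  have hl : (s.take a).length = a := by simp; omega
  rcases lt_or_ge i a with h1 | h1
  · rw [List.append_assoc, List.getElem?_append_left (by omega), List.getElem?_take_of_lt h1]
  · obtain ⟨i, rfl⟩ := Nat.exists_eq_add_of_le h1
    rcases lt_or_ge i m.length with h2 | h2
    · rw [List.append_assoc, List.getElem?_append_right (by omega), hl, Nat.add_sub_cancel_left,
        List.getElem?_append_left h2, hm i h2]
    · obtain ⟨i, rfl⟩ := Nat.exists_eq_add_of_le h2
      rw [List.getElem?_append_right (by simp only [List.length_append]; omega),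
        List.getElem?_drop, List.length_append, hl]
      congr 1
      omega

theorem splice_of_getElem? {α : Type*} {a : ℕ} {m m' s t : List α} (h : a + m.length ≤ s.length)
    (h' : a + m'.length ≤ t.length) (h₁ : ∀ j < a, s[j]? = t[j]?)
    (h₂ : ∀ j, s[a + m.length + j]? = t[a + m'.length + j]?)
    (hm : ∀ i < m.length, s[a + i]? = m[i]?) (hm' : ∀ i < m'.length, t[a + i]? = m'[i]?) :
    Splice a m m' s t := by
  refine ⟨s.take a, s.drop (a + m.length), by simp; omega, eq_append_of_getElem? h hm, ?_⟩
  have h3 : s.take a = t.take a := by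
    refine List.ext_getElem? fun i => ?_
    rcases lt_or_ge i a with h1 | h1
    · rw [List.getElem?_take_of_lt h1, List.getElem?_take_of_lt h1, h₁ i h1]
    · rw [List.getElem?_eq_none (by simp; omega), List.getElem?_eq_none (by simp; omega)]
  have h4 : s.drop (a + m.length) = t.drop (a + m'.length) := by
    refine List.ext_getElem? fun i => ?_
    rw [List.getElem?_drop, List.getElem?_drop, h₂]
  rw [h3, h4]
  exact eq_append_of_getElem? h' hm'

/-- `c.DirTr m m'` says that `m` and `m'` can be the directions below and above a piece of
kind `c`. -/
inductive Kind.DirTr : Kind → List Bool → List Bool → Prop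
  | cup (o : Bool) : DirTr (.cup o) [] [o, !o]
  | cap (x : Bool) : DirTr .cap [x, !x] []
  | cross (b x y : Bool) : DirTr (.cross b) [x, y] [y, x]

theorem Kind.DirTr.length_eq {c : Kind} {m m' : List Bool} (h : c.DirTr m m') :
    m.length = c.inputs ∧ m'.length = c.outputs := by
  cases h <;> simp [Kind.inputs, Kind.outputs]

theorem Kind.Tr.length_eq {c : Kind} {m m' : List S3} (h : c.Tr m m') :
    m.length = c.inputs ∧ m'.length = c.outputs := by
  cases h <;> simp [Kind.inputs, Kind.outputs]

theorem splice_of_step {P : Layer} {s t : List Bool} (h : P.step s = some t) :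
    ∃ m m', P.kind.DirTr m m' ∧ Splice P.pos m m' s t := by
  obtain ⟨c, a⟩ := P
  induction a generalizing s t with
  | zero =>
    simp only [splice_zero]
    cases c with
    | cup o =>
      simp only [step_cup_zero, Option.some.injEq] at h
      exact ⟨_, _, .cup o, s, rfl, h.symm⟩
    | cap =>
      rcases s with _ | ⟨x, _ | ⟨y, s⟩⟩ <;> simp at h
      obtain ⟨rfl, rfl⟩ := h
      exact ⟨_, _, .cap x, s, rfl, rfl⟩
    | cross b =>
      rcases s with _ | ⟨x, _ | ⟨y, s⟩⟩ <;> simp at h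
      exact ⟨_, _, .cross b x y, s, rfl, h.symm⟩
  | succ a ih =>
    cases s with
    | nil => simp [step_succ_nil] at h
    | cons x s =>
      simp only [step_succ_cons, Option.map_eq_some_iff] at h
      obtain ⟨t', h, rfl⟩ := h
      obtain ⟨m, m', h1, h2⟩ := ih h
      exact ⟨m, m', h1, splice_succ.2 ⟨x, s, t', rfl, rfl, h2⟩⟩

namespace Diagram

variable (D : Diagram)

theorem level_zero : D.level 0 = [] := by simp [level]

theorem level_of_length_le {k : ℕ} (h : D.word.length ≤ k) : D.level k = [] := by
  simp [level, List.take_of_length_le h, D.closed]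

theorem step_level {k : ℕ} {P : Layer} (h : D.word[k]? = some P) :
    P.step (D.level k) = some (D.level (k + 1)) := by
  have h1 := D.closed
  rw [← List.take_append_drop (k + 1) D.word, run_append] at h1
  obtain ⟨t, h1, -⟩ := Option.bind_eq_some_iff.1 h1
  have h2 : D.level (k + 1) = t := by simp [level, h1]
  rw [List.take_add_one, h, run_append] at h1
  obtain ⟨s, h1, h3⟩ := Option.bind_eq_some_iff.1 h1
  have h4 : D.level k = s := by simp [level, h1]
  rw [h2, h4]
  simpa [funext run_nil] using h3

/-- The number of the line of a point is less than the length of the word. -/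
theorem Point.lt_length {D : Diagram} (p : D.Point) : p.1.1 < D.word.length := by
  by_contra h
  have := p.2
  simp [D.level_of_length_le (not_lt.1 h)] at this

end Diagram

/-- The color that belongs to a signed color, and conversely, on a strand of direction `d`. -/
def toSigned (d : Bool) (g : S3) : S3 := if d then g else g⁻¹

@[simp] theorem toSigned_true (g : S3) : toSigned true g = g := rfl

@[simp] theorem toSigned_false (g : S3) : toSigned false g = g⁻¹ := rfl

@[simp] theorem toSigned_toSigned (d : Bool) (g : S3) : toSigned d (toSigned d g) = g := by
  cases d <;> simp

theorem toSigned_not (d : Bool) (g : S3) : toSigned (!d) g = (toSigned d g)⁻¹ := by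
  cases d <;> simp

theorem toSigned_eq_one {d : Bool} {g : S3} : toSigned d g = 1 ↔ g = 1 := by
  cases d <;> simp

theorem sign_toSigned (d : Bool) (g : S3) :
    Equiv.Perm.sign (toSigned d g) = Equiv.Perm.sign g := by
  cases d <;> simp

/-- The condition at a crossing in terms of signed colors. Here `g` is the color of the over
strand, `u` and `t` are the colors of the lower and the upper end of the under strand, and `d`, `e`
are the directions of the over and the under strand. -/
theorem crossing_condition_iff (b d e : Bool) (g u t : S3) :
    (if (b == (d == e)) then g * (if e then u else t) = (if e then t else u) * g
      else g * (if e then t else u) = (if e then u else t) * g) ↔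
    toSigned e t = if b then toSigned d g * toSigned e u * (toSigned d g)⁻¹
      else (toSigned d g)⁻¹ * toSigned e u * toSigned d g := by
  have k1 : ∀ x y z : S3, x * y = z * x ↔ z = x * y * x⁻¹ := fun x y z => by
    rw [eq_mul_inv_iff_mul_eq, eq_comm]
  have k2 : ∀ x y z : S3, x * y = z * x ↔ y = x⁻¹ * z * x := fun x y z => by
    rw [mul_assoc, eq_inv_mul_iff_mul_eq]
  have k3 : ∀ x y z : S3, x * y = z * x ↔ z⁻¹ = x * y⁻¹ * x⁻¹ := fun x y z => by
    rw [k1, ← inv_inj]; simp [mul_assoc]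
  have k4 : ∀ x y z : S3, x * y = z * x ↔ y⁻¹ = x⁻¹ * z⁻¹ * x := fun x y z => by
    rw [k2, ← inv_inj]; simp [mul_assoc]
  cases b <;> cases d <;> cases e <;> simp
  exacts [k3 _ _ _, k1 _ _ _, k4 _ _ _, k2 _ _ _, k4 _ _ _, k2 _ _ _, k3 _ _ _, k1 _ _ _]

/-- Signed colors `ℓ k` on the horizontal lines that are compatible with the layers of a word. -/
def IsLeveling (w : List Layer) (ℓ : ℕ → List S3) : Prop :=
  ∀ k P, w[k]? = some P → CStep P (ℓ k) (ℓ (k + 1))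

theorem IsLeveling.col {w : List Layer} {ℓ : ℕ → List S3} (h : IsLeveling w ℓ) :
    Col w (ℓ 0) (ℓ w.length) {ε | ∃ k ≤ w.length, ε ∈ signs (ℓ k)} := by
  induction w generalizing ℓ with
  | nil => exact ⟨rfl, by ext; simp⟩
  | cons P w ih =>
    have h1 : IsLeveling w fun k => ℓ (k + 1) := fun k Q hQ => h (k + 1) Q (by simpa using hQ)
    refine ⟨ℓ 1, _, h 0 P (by simp), ih h1, ?_⟩
    ext ε
    constructor
    · rintro ⟨_ | k, hk, hε⟩
      · exact .inl hε
      · exact .inr ⟨k, by simpa using hk, hε⟩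
    · rintro (hε | ⟨k, hk, hε⟩)
      · exact ⟨0, by simp, hε⟩
      · exact ⟨k + 1, by simpa using hk, hε⟩

theorem IsLeveling.isNontrivial {w : List Layer} {ℓ : ℕ → List S3} (h : IsLeveling w ℓ)
    (h0 : ℓ 0 = []) (k : ℕ) (hk : k ≤ w.length) : IsNontrivial (ℓ k) := by
  induction k with
  | zero => simp [h0, IsNontrivial]
  | succ k ih => exact (ih (by omega)).of_cstep (h k w[k] (by simp))

theorem IsLeveling.length_eq {D : Diagram} {ℓ : ℕ → List S3} (h : IsLeveling D.word ℓ)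
    (h0 : ℓ 0 = []) (k : ℕ) (hk : k ≤ D.word.length) : (ℓ k).length = (D.level k).length := by
  induction k with
  | zero => simp [h0, D.level_zero]
  | succ k ih =>
    have hP : D.word[k]? = some D.word[k] := by simp
    have h1 := length_of_cstep (h k _ hP)
    have h2 := length_of_step _ (D.step_level hP)
    have h3 := ih (by omega)
    omega

namespace Diagram

variable {D : Diagram}

theorem getElem?_level (p : D.Point) : (D.level p.1.1)[p.1.2]? = some (D.direction p) :=
  List.getElem?_eq_getElem p.2

/-- Signed colors on the horizontal lines define a coloring. -/
theorem exists_coloring_of_isLeveling {ℓ : ℕ → List S3} (h : IsLeveling D.word ℓ)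
    (h0 : ℓ 0 = []) :
    ∃ Γ : D.Arc → {g : S3 // g ≠ 1}, D.IsColoring Γ ∧
      ∀ p : D.Point, (ℓ p.1.1)[p.1.2]? = some (toSigned (D.direction p) (Γ (D.arc p))) := by
  let f : D.Point → S3 := fun p =>
    toSigned ((D.level p.1.1)[p.1.2]?.getD true) ((ℓ p.1.1)[p.1.2]?.getD 1)
  have hget : ∀ p : D.Point, ∃ g, g ≠ 1 ∧ (ℓ p.1.1)[p.1.2]? = some g ∧
      f p = toSigned (D.direction p) g := fun p => by
    have hp := p.2
    rw [← h.length_eq h0 _ p.lt_length.le] at hp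
    refine ⟨(ℓ p.1.1)[p.1.2], ?_, List.getElem?_eq_getElem hp, ?_⟩
    · exact h.isNontrivial h0 _ p.lt_length.le _ (List.getElem_mem hp)
    · simp only [f, getElem?_level, List.getElem?_eq_getElem hp, Option.getD_some]
  have hf1 : ∀ p, f p ≠ 1 := fun p => by
    obtain ⟨g, hg, -, hp⟩ := hget p
    rw [hp, Ne, toSigned_eq_one]
    exact hg
  have hf : ∀ p q, D.Joined p q → f p = f q := by
    rintro ⟨p, hp⟩ ⟨q, hq⟩ ⟨k, P, hP, hJ⟩
    obtain ⟨m, m', hm, hs⟩ := h k P hP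
    obtain ⟨n, n', hn, hd⟩ := splice_of_step (D.step_level hP)
    obtain ⟨s1, s2, s3, s4⟩ := hs.getElem?
    obtain ⟨d1, d2, d3, d4⟩ := hd.getElem?
    have lm := hm.length_eq
    have ln := hn.length_eq
    simp only [f]
    cases hJ with
    | left c a j hj => simp only at s1 d1; rw [s1 j hj, d1 j hj]
    | right c a j =>
      rw [lm.1, lm.2] at s2
      rw [ln.1, ln.2] at d2
      simp only at s2 d2
      rw [s2 j, d2 j]
    | cup o a =>
      cases hm with | cup o g hg =>
      cases hn with | cup o =>
      have e1 := s4 0 (by simp)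
      have e2 := s4 1 (by simp)
      have e3 := d4 0 (by simp)
      have e4 := d4 1 (by simp)
      simp only [add_zero] at e1 e2 e3 e4
      rw [e1, e2, e3, e4]
      simp [toSigned_not]
      cases o <;> simp
    | cap a =>
      cases hm with | cap g =>
      cases hn with | cap x =>
      have e1 := s3 0 (by simp)
      have e2 := s3 1 (by simp)
      have e3 := d3 0 (by simp)
      have e4 := d3 1 (by simp)
      simp only [add_zero] at e1 e2 e3 e4
      rw [e1, e2, e3, e4]
      simp [toSigned_not]
      cases x <;> simp
    | overRising a =>
      cases hm
      cases hn
      have e1 := s3 0 (by simp)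
      have e2 := s4 1 (by simp)
      have e3 := d3 0 (by simp)
      have e4 := d4 1 (by simp)
      simp only [add_zero] at e1 e2 e3 e4
      rw [e1, e2, e3, e4]
      simp
    | overFalling a =>
      cases hm
      cases hn
      have e1 := s3 1 (by simp)
      have e2 := s4 0 (by simp)
      have e3 := d3 1 (by simp)
      have e4 := d4 0 (by simp)
      simp only [add_zero] at e1 e2 e3 e4
      rw [e1, e2, e3, e4]
      simp
  have hc : ∀ s x y z, D.IsCrossing s x y z →
      if s then Quot.lift f hf x * Quot.lift f hf y = Quot.lift f hf z * Quot.lift f hf x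
      else Quot.lift f hf x * Quot.lift f hf z = Quot.lift f hf y * Quot.lift f hf x := by
    rintro s x y z ⟨k, a, b, p, u, t, hP, hp, hu, ht, rfl, rfl, rfl, rfl⟩
    have key := (crossing_condition_iff b (D.direction p) (D.direction u) (f p) (f u) (f t)).2
    obtain ⟨g, -, hp1, hp2⟩ := hget p
    obtain ⟨g', -, hu1, hu2⟩ := hget u
    obtain ⟨g'', -, ht1, ht2⟩ := hget t
    have hp3 := getElem?_level p
    have hu3 := getElem?_level u
    have ht3 := getElem?_level t
    rw [hp] at hp1 hp3
    rw [hu] at hu1 hu3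
    rw [ht] at ht1 ht3
    obtain ⟨m, m', hm, hs⟩ := h k _ hP
    obtain ⟨n, n', hn, hd⟩ := splice_of_step (D.step_level hP)
    obtain ⟨-, -, s3, s4⟩ := hs.getElem?
    obtain ⟨-, -, d3, d4⟩ := hd.getElem?
    have hdir : D.direction t = D.direction u ∧
        g'' = if b then g * g' * g⁻¹ else g⁻¹ * g' * g := by
      cases hm with
      | crossOver x y =>
        cases hn with | cross _ v w =>
        have e1 := s3 0 (by simp)
        have e2 := s3 1 (by simp)
        have e3 := s4 0 (by simp)
        have e4 := d3 1 (by simp)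
        have e5 := d4 0 (by simp)
        simp at e1 e2 e3 e4 e5 hp1 hu1 ht1 hu3 ht3
        simp_all
      | crossUnder x y =>
        cases hn with | cross _ v w =>
        have e1 := s3 0 (by simp)
        have e2 := s3 1 (by simp)
        have e3 := s4 1 (by simp)
        have e4 := d3 0 (by simp)
        have e5 := d4 1 (by simp)
        simp at e1 e2 e3 e4 e5 hp1 hu1 ht1 hu3 ht3
        simp_all
    have := key (by
      rw [ht2, hu2, hp2, hdir.1, toSigned_toSigned, toSigned_toSigned, toSigned_toSigned]
      exact hdir.2)
    convert this using 2 <;> cases D.direction u <;> rfl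
  refine ⟨fun x => ⟨Quot.lift f hf x, ?_⟩, ⟨fun x y z hxyz => ?_, fun x y z hxyz => ?_⟩,
    fun p => ?_⟩
  · induction x using Quot.ind with | mk p => exact hf1 p
  · simpa using hc true x y z hxyz
  · simpa using hc false x y z hxyz
  · obtain ⟨g, -, h1, h2⟩ := hget p
    rw [h1]
    change some g = some (toSigned _ (f p))
    rw [h2, toSigned_toSigned]

/-- The signed color at a point. -/
def signedColor (Γ : D.Arc → {g : S3 // g ≠ 1}) (p : D.Point) : S3 :=
  toSigned (D.direction p) (Γ (D.arc p))

/-- The signed colors on a horizontal line. -/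
def signedLevel (Γ : D.Arc → {g : S3 // g ≠ 1}) (k : ℕ) : List S3 :=
  List.ofFn fun j : Fin (D.level k).length => signedColor Γ ⟨(k, j), j.2⟩

theorem getElem?_signedLevel (Γ : D.Arc → {g : S3 // g ≠ 1}) (p : D.Point) :
    (signedLevel Γ p.1.1)[p.1.2]? = some (signedColor Γ p) := by
  have hp := p.2
  rw [signedLevel, List.getElem?_ofFn]
  simp only [hp, dif_pos]
  rfl

/-- The signed colors agree at the ends of a strand that connects two horizontal lines. -/
theorem getElem?_signedLevel_congr {Γ : D.Arc → {g : S3 // g ≠ 1}} {k l i j : ℕ}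
    (h : (D.level k)[i]? = (D.level l)[j]?)
    (hJ : ∀ p q : D.Point, p.1 = (k, i) → q.1 = (l, j) → D.Joined p q) :
    (signedLevel Γ k)[i]? = (signedLevel Γ l)[j]? := by
  by_cases hi : i < (D.level k).length
  · have hj : j < (D.level l).length := by
      by_contra hj
      rw [List.getElem?_eq_none (not_lt.1 hj), List.getElem?_eq_getElem hi] at h
      simp at h
    have h1 := getElem?_signedLevel Γ ⟨(k, i), hi⟩
    have h2 := getElem?_signedLevel Γ ⟨(l, j), hj⟩
    have h3 : D.arc ⟨(k, i), hi⟩ = D.arc ⟨(l, j), hj⟩ := Quot.sound (hJ _ _ rfl rfl)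
    have h4 : D.direction ⟨(k, i), hi⟩ = D.direction ⟨(l, j), hj⟩ := by
      have h5 := getElem?_level (⟨(k, i), hi⟩ : D.Point)
      have h6 := getElem?_level (⟨(l, j), hj⟩ : D.Point)
      simp only at h5 h6
      rw [h, h6] at h5
      exact (Option.some.inj h5).symm
    simp only [signedColor, h3, h4] at h1 h2
    rw [h1, h2]
  · rw [List.getElem?_eq_none (by simpa [signedLevel] using hi),
      List.getElem?_eq_none]
    rw [List.getElem?_eq_none (not_lt.1 hi), eq_comm, List.getElem?_eq_none_iff] at h
    simpa [signedLevel] using h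

/-- A coloring defines signed colors on the horizontal lines. -/
theorem IsColoring.isLeveling {Γ : D.Arc → {g : S3 // g ≠ 1}} (hΓ : D.IsColoring Γ) :
    IsLeveling D.word (signedLevel Γ) := by
  rintro k P hP
  obtain ⟨n, n', hn, hd⟩ := splice_of_step (D.step_level hP)
  obtain ⟨d1, d2, d3, d4⟩ := hd.getElem?
  have ln := hn.length_eq
  have hlen : P.pos + n.length ≤ (D.level k).length ∧
      P.pos + n'.length ≤ (D.level (k + 1)).length := by
    obtain ⟨l, r, hl, h1, h2⟩ := hd
    constructor
    · rw [h1]; simp [hl]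
    · rw [h2]; simp [hl]
  rw [ln.1, ln.2] at hlen d2
  rw [ln.1] at d3
  rw [ln.2] at d4
  -- It remains to find the signed colors below and above the piece of the layer.
  suffices h : ∃ m m', P.kind.Tr m m' ∧ (∀ i < m.length, (signedLevel Γ k)[P.pos + i]? = m[i]?) ∧
      ∀ i < m'.length, (signedLevel Γ (k + 1))[P.pos + i]? = m'[i]? by
    obtain ⟨m, m', hm, s3, s4⟩ := h
    have lm := hm.length_eq
    refine ⟨m, m', hm, splice_of_getElem? ?_ ?_ (fun j hj => ?_) (fun j => ?_) s3 s4⟩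
    · rw [lm.1, signedLevel, List.length_ofFn]; exact hlen.1
    · rw [lm.2, signedLevel, List.length_ofFn]; exact hlen.2
    · refine getElem?_signedLevel_congr (d1 j hj) fun p q hp hq => ⟨k, P, hP, ?_⟩
      rw [hp, hq]
      exact .left P.kind P.pos j hj
    · rw [lm.1, lm.2]
      refine getElem?_signedLevel_congr (d2 j) fun p q hp hq => ⟨k, P, hP, ?_⟩
      rw [hp, hq]
      exact .right P.kind P.pos j
  obtain ⟨c, a⟩ := P
  simp only at *
  have sc : ∀ (p : D.Point) {k i : ℕ} {d : Bool}, p.1 = (k, i) → (D.level k)[i]? = some d →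
      (signedLevel Γ k)[i]? = some (toSigned d (Γ (D.arc p))) ∧ D.direction p = d := by
    rintro ⟨_, hp⟩ k i d rfl h
    have h1 := getElem?_level (⟨(k, i), hp⟩ : D.Point)
    have h2 : D.direction (⟨(k, i), hp⟩ : D.Point) = d := by
      simp only at h1
      rw [h] at h1
      exact (Option.some.inj h1).symm
    exact ⟨by rw [← h2]; exact getElem?_signedLevel Γ ⟨(k, i), hp⟩, h2⟩
  cases c with
  | cup o =>
    cases hn with | cup o =>
    simp only [Kind.outputs] at hlen
    let p : D.Point := ⟨(k + 1, a), by simp only; omega⟩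
    let q : D.Point := ⟨(k + 1, a + 1), by simp only; omega⟩
    have hpq : D.arc p = D.arc q := Quot.sound ⟨k, _, hP, .cup o a⟩
    obtain ⟨h1, -⟩ := sc p rfl (d4 0 (by simp [Kind.outputs]))
    obtain ⟨h2, -⟩ := sc q rfl (d4 1 (by simp [Kind.outputs]))
    refine ⟨_, _, .cup o (toSigned o (Γ (D.arc p))) ?_, by simp, fun i hi => ?_⟩
    · rw [Ne, toSigned_eq_one]; exact (Γ _).2
    · simp only [List.length_cons, List.length_nil] at hi
      interval_cases i
      · simpa using h1
      · rw [h2, ← hpq, ← toSigned_not]; rfl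
  | cap =>
    cases hn with | cap x =>
    simp only [Kind.inputs] at hlen
    let p : D.Point := ⟨(k, a), by simp only; omega⟩
    let q : D.Point := ⟨(k, a + 1), by simp only; omega⟩
    have hpq : D.arc p = D.arc q := Quot.sound ⟨k, _, hP, .cap a⟩
    obtain ⟨h1, -⟩ := sc p rfl (d3 0 (by simp [Kind.inputs]))
    obtain ⟨h2, -⟩ := sc q rfl (d3 1 (by simp [Kind.inputs]))
    refine ⟨_, _, .cap (toSigned x (Γ (D.arc p))), fun i hi => ?_, by simp⟩
    simp only [List.length_cons, List.length_nil] at hi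
    interval_cases i
    · simpa using h1
    · rw [h2, ← hpq, ← toSigned_not]; rfl
  | cross b =>
    cases hn with | cross _ x y =>
    simp only [Kind.inputs, Kind.outputs] at hlen
    let p₀ : D.Point := ⟨(k, a), by simp only; omega⟩
    let p₁ : D.Point := ⟨(k, a + 1), by simp only; omega⟩
    let q₀ : D.Point := ⟨(k + 1, a), by simp only; omega⟩
    let q₁ : D.Point := ⟨(k + 1, a + 1), by simp only; omega⟩
    obtain ⟨h1, e1⟩ := sc p₀ rfl (d3 0 (by simp [Kind.inputs]))
    obtain ⟨h2, e2⟩ := sc p₁ rfl (d3 1 (by simp [Kind.inputs]))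
    obtain ⟨h3, e3⟩ := sc q₀ rfl (d4 0 (by simp [Kind.outputs]))
    obtain ⟨h4, e4⟩ := sc q₁ rfl (d4 1 (by simp [Kind.outputs]))
    have hcond : ∀ p u t : D.Point, p.1 = (k, if b then a else a + 1) →
        u.1 = (k, if b then a + 1 else a) → t.1 = (k + 1, if b then a else a + 1) →
        toSigned (D.direction u) (Γ (D.arc t)) =
          if b then toSigned (D.direction p) (Γ (D.arc p)) *
            toSigned (D.direction u) (Γ (D.arc u)) * (toSigned (D.direction p) (Γ (D.arc p)))⁻¹
          else (toSigned (D.direction p) (Γ (D.arc p)))⁻¹ *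
            toSigned (D.direction u) (Γ (D.arc u)) * toSigned (D.direction p) (Γ (D.arc p)) := by
      intro p u t hp hu ht
      rw [← crossing_condition_iff]
      have hX : D.IsCrossing (b == (D.direction p == D.direction u)) _ _ _ :=
        ⟨k, a, b, p, u, t, hP, hp, hu, ht, rfl, rfl, rfl, rfl⟩
      have h5 : ∀ s x y z, D.IsCrossing s x y z →
          if s then (Γ x : S3) * Γ y = Γ z * Γ x else (Γ x : S3) * Γ z = Γ y * Γ x := by
        rintro (_ | _) x y z h
        · simpa using hΓ.2 x y z h
        · simpa using hΓ.1 x y z h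
      convert h5 _ _ _ _ hX using 2 <;> cases D.direction u <;> rfl
    cases b with
    | true =>
      have h5 := hcond p₀ p₁ q₀ rfl rfl rfl
      have hpq : D.arc p₀ = D.arc q₁ := Quot.sound ⟨k, _, hP, .overRising a⟩
      rw [e1, e2] at h5
      refine ⟨_, _, .crossOver (toSigned x (Γ (D.arc p₀))) (toSigned y (Γ (D.arc p₁))),
        fun i hi => ?_, fun i hi => ?_⟩ <;> simp only [List.length_cons, List.length_nil] at hi <;> interval_cases i
      · simpa using h1
      · simpa using h2
      · rw [add_zero, h3, h5]; rfl
      · rw [h4, ← hpq]; rfl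
    | false =>
      have h5 := hcond p₁ p₀ q₁ rfl rfl rfl
      have hpq : D.arc p₁ = D.arc q₀ := Quot.sound ⟨k, _, hP, .overFalling a⟩
      rw [e1, e2] at h5
      refine ⟨_, _, .crossUnder (toSigned x (Γ (D.arc p₀))) (toSigned y (Γ (D.arc p₁))),
        fun i hi => ?_, fun i hi => ?_⟩ <;> simp only [List.length_cons, List.length_nil] at hi <;> interval_cases i
      · simpa using h1
      · simpa using h2
      · rw [add_zero, h3, ← hpq]; rfl
      · rw [h4, h5]; rfl

/-- If a coloring uses all colors, then both signs occur among the signed colors. -/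
theorem IsColoring.col_univ {Γ : D.Arc → {g : S3 // g ≠ 1}} (hΓ : D.IsColoring Γ)
    (hs : Function.Surjective Γ) : Col D.word [] [] Set.univ := by
  have h := hΓ.isLeveling.col
  have h0 : signedLevel Γ 0 = [] := by
    rw [← List.length_eq_zero_iff, signedLevel, List.length_ofFn, D.level_zero]; rfl
  have h1 : signedLevel Γ D.word.length = [] := by
    rw [← List.length_eq_zero_iff, signedLevel, List.length_ofFn, D.level_of_length_le le_rfl]; rfl
  rw [h0, h1] at h
  convert h
  symm
  rw [Set.eq_univ_iff_forall]
  have key : ∀ g : {g : S3 // g ≠ 1},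
      ∃ k ≤ D.word.length, Equiv.Perm.sign (g : S3) ∈ signs (signedLevel Γ k) := by
    intro g
    obtain ⟨x, rfl⟩ := hs g
    induction x using Quot.ind with | mk p =>
    refine ⟨p.1.1, p.lt_length.le, _, List.mem_of_getElem? (getElem?_signedLevel Γ p), ?_⟩
    rw [signedColor, sign_toSigned]
    rfl
  intro ε
  rcases Int.units_eq_one_or ε with rfl | rfl
  · have := key ⟨finRotate 3, by decide⟩
    rwa [show Equiv.Perm.sign (finRotate 3) = 1 by decide] at this
  · have := key ⟨Equiv.swap 0 1, by decide⟩
    rwa [show Equiv.Perm.sign (Equiv.swap (0 : Fin 3) 1) = -1 by decide] at this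

end Diagram

/-! ### Reduction to plat closures of full twists -/

/-- The two maxima that close a braid on four strands. -/
def caps : List Layer := [⟨.cap, 0⟩, ⟨.cap, 0⟩]

theorem IsCrossWord.exists_layers {x : List Layer} (hx : IsCrossWord x) {d d' : List Bool}
    (h : run x d = some d') (hd : d.length = 4) : ∃ β : BraidWord, x = β.layers := by
  induction x generalizing d with
  | nil => exact ⟨[], rfl⟩
  | cons P x ih =>
    obtain ⟨b, a, rfl⟩ := hx P (by simp)
    obtain ⟨e, he, h⟩ := Option.bind_eq_some_iff.1 h
    have h1 := pos_le_of_step he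
    have h2 := length_of_step _ he
    simp only [Kind.inputs, Kind.outputs] at h1 h2
    obtain ⟨β, rfl⟩ := ih (fun Q hQ => hx Q (by simp [hQ])) h (by omega)
    exact ⟨(⟨a, by omega⟩, b) :: β, rfl⟩

theorem IsCrossWord.length_eq {x : List Layer} (hx : IsCrossWord x) {d d' : List Bool}
    (h : run x d = some d') : d'.length = d.length := by
  induction x generalizing d with
  | nil => simp at h; rw [h]
  | cons P x ih =>
    obtain ⟨b, a, rfl⟩ := hx P (by simp)
    obtain ⟨e, he, h⟩ := Option.bind_eq_some_iff.1 h
    have h2 := length_of_step _ he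
    simp only [Kind.inputs, Kind.outputs] at h2
    rw [ih (fun Q hQ => hx Q (by simp [hQ])) h]
    omega

theorem exists_run_cups (os : List Bool) (d : List Bool) :
    ∃ d', run (os.map fun o => ⟨.cup o, 0⟩) d = some d' ∧ d'.length = d.length + 2 * os.length := by
  induction os generalizing d with
  | nil => exact ⟨d, rfl, by simp⟩
  | cons o os ih =>
    obtain ⟨d', h, hl⟩ := ih (o :: (!o) :: d)
    exact ⟨d', by simpa using h, by simp at hl ⊢; omega⟩

/-- A link that has a diagram with two maxima is a plat closure of a braid on four strands. -/
theorem Diagram.exists_plat (D : Diagram) (hD : D.maxima = 2) :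
    ∃ (o₁ o₂ : Bool) (β : BraidWord) (hw : run (plat o₁ o₂ β ++ caps) [] = some []),
      (Quot.mk Diagram.Move ⟨_, hw⟩ : Link) = Quot.mk Diagram.Move D := by
  obtain ⟨w, hw, h1⟩ := exists_iso_caps_at_top D.word
  obtain ⟨os, x, hx, h2⟩ := hw.exists_iso_cups_at_bottom
  have hc : capCount D.word = 2 := hD
  rw [hc] at h1
  have h3 : Iso D.word (os.map (fun o => ⟨.cup o, 0⟩) ++ x ++ caps) :=
    h1.trans (h2.append_right caps)
  have h4 := (Iso.run_eq h3 []).symm.trans D.closed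
  rw [List.append_assoc, run_append] at h4
  obtain ⟨d, hd, hl⟩ := exists_run_cups os []
  rw [hd, Option.bind_some, run_append] at h4
  obtain ⟨e, he, h4⟩ := Option.bind_eq_some_iff.1 h4
  have hl' := hx.length_eq he
  have h5 : e.length = 4 := by
    obtain ⟨e', h5, h4⟩ := Option.bind_eq_some_iff.1 h4
    obtain ⟨e'', h6, h4⟩ := Option.bind_eq_some_iff.1 h4
    have h7 := length_of_step _ h5
    have h8 := length_of_step _ h6
    simp at h4
    subst h4
    simp only [Kind.inputs, Kind.outputs, List.length_nil] at h7 h8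
    omega
  obtain ⟨β, rfl⟩ := hx.exists_layers he (by omega)
  have hos : os.length = 2 := by simp at hl; omega
  obtain ⟨o₁, o₂, rfl⟩ := List.length_eq_two.1 hos
  exact ⟨o₁, o₂, β, (Iso.run_eq h3 []).symm.trans D.closed, (h3.link_eq _ _).symm⟩

theorem signs_of_cross {b : Bool} {a : ℕ} {s t : List S3} (h : CStep ⟨.cross b, a⟩ s t) :
    signs t = signs s := by
  induction a generalizing s t with
  | zero =>
    obtain ⟨x, y, r, rfl, rfl⟩ := cstep_cross_zero.1 h
    cases b <;> simp [mul_comm, mul_left_comm, units_mul_self_mul, Set.insert_comm]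
  | succ a ih =>
    obtain ⟨x, s, t, rfl, rfl, h'⟩ := cstep_succ.1 h
    rw [signs_cons, signs_cons, ih h']

theorem Col.signs_eq {β : BraidWord} {s t : List S3} {E : Set ℤˣ} (h : Col β.layers s t E) :
    E = signs s := by
  induction β generalizing s E with
  | nil => exact h.2
  | cons p β ih =>
    obtain ⟨m, E', hm, h, rfl⟩ := h
    rw [ih h, signs_of_cross hm, Set.union_self]

theorem Col.signs_top_eq {β : BraidWord} {s t : List S3} {E : Set ℤˣ} (h : Col β.layers s t E) :
    signs t = signs s := by
  induction β generalizing s E with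
  | nil => rw [h.1]
  | cons p β ih =>
    obtain ⟨m, E', hm, h, rfl⟩ := h
    rw [ih h, signs_of_cross hm]

/-- Two crossings of the same pair of strands restore the signs. -/
theorem map_sign_of_cross_cross {b b' : Bool} {a : ℕ} {s m t : List S3}
    (h : CStep ⟨.cross b, a⟩ s m) (h' : CStep ⟨.cross b', a⟩ m t) :
    t.map Equiv.Perm.sign = s.map Equiv.Perm.sign := by
  induction a generalizing s m t with
  | zero =>
    obtain ⟨x, y, r, rfl, rfl⟩ := cstep_cross_zero.1 h
    cases b <;> cases b' <;> simp at h' <;> subst h' <;>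
      simp [mul_assoc, mul_comm, mul_left_comm, units_mul_self_mul]
  | succ a ih =>
    obtain ⟨x, s, m, rfl, rfl, h₁⟩ := cstep_succ.1 h
    obtain ⟨t, rfl, h₂⟩ := cstep_succ_cons.1 h'
    simp [ih h₁ h₂]

theorem twists_cons (i : Fin 3) (p : Bool × Bool) (e : List (Bool × Bool)) :
    twists i (p :: e) =
      (if p.1 then 1 else i, p.2) :: (if p.1 then 1 else i, p.2) :: twists i e := by
  simp [twists]

/-- Full twists do not permute the signs of the strands. -/
theorem Col.map_sign_eq {i : Fin 3} {e : List (Bool × Bool)} {s t : List S3} {E : Set ℤˣ}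
    (h : Col (twists i e).layers s t E) : t.map Equiv.Perm.sign = s.map Equiv.Perm.sign := by
  induction e generalizing s E with
  | nil => rw [h.1]
  | cons p e ih =>
    rw [twists_cons] at h
    obtain ⟨m, _, h1, ⟨m', E', h2, h, -⟩, -⟩ := h
    exact (ih h).trans (map_sign_of_cross_cross h1 h2)

/-- The signed colors above two minima. -/
theorem Col.exists_of_plat {o₁ o₂ : Bool} {β : BraidWord} {t : List S3} {E : Set ℤˣ}
    (h : Col (plat o₁ o₂ β) [] t E) :
    ∃ g h : S3, g ≠ 1 ∧ h ≠ 1 ∧ Col β.layers [g, g⁻¹, h, h⁻¹] t E ∧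
      E = {Equiv.Perm.sign g, Equiv.Perm.sign h} := by
  obtain ⟨_, _, h1, ⟨_, E', h2, h, rfl⟩, rfl⟩ := h
  obtain ⟨y, hy, rfl⟩ := cstep_cup_zero.1 h1
  obtain ⟨x, hx, rfl⟩ := cstep_cup_zero.1 h2
  have hE := h.signs_eq
  have key : signs [] ∪ (signs (y :: y⁻¹ :: []) ∪ E') = E' := by
    rw [hE]; ext ε; simp
  rw [key]
  refine ⟨x, y, hx, hy, h, hE.trans ?_⟩
  simp

theorem Col.sign_eq_of_caps {x₁ x₂ x₃ x₄ : S3} {E : Set ℤˣ}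
    (h : Col caps [x₁, x₂, x₃, x₄] [] E) : Equiv.Perm.sign x₁ = Equiv.Perm.sign x₂ := by
  obtain ⟨m, E', h1, -, -⟩ := h
  obtain ⟨g, h1⟩ := cstep_cap_zero.1 h1
  simp only [List.cons.injEq] at h1
  rw [h1.2.1, h1.1, map_inv, Int.units_inv_eq_self]

theorem Col.caps_eq {s : List S3} {E : Set ℤˣ} (h : Col caps s [] E) : E = signs s := by
  obtain ⟨m, _, h1, ⟨_, _, h2, ⟨rfl, rfl⟩, rfl⟩, rfl⟩ := h
  obtain ⟨g, rfl⟩ := cstep_cap_zero.1 h1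
  obtain ⟨g', rfl⟩ := cstep_cap_zero.1 h2
  ext ε; simp

/-- If both signs occur in the plat closure of a braid, then the two minima have different signs. -/
theorem Col.exists_of_plat_caps {o₁ o₂ : Bool} {β : BraidWord}
    (h : Col (plat o₁ o₂ β ++ caps) [] [] Set.univ) :
    ∃ (g h : S3) (t : List S3) (E E' : Set ℤˣ), g ≠ 1 ∧ h ≠ 1 ∧
      Equiv.Perm.sign g ≠ Equiv.Perm.sign h ∧ Col β.layers [g, g⁻¹, h, h⁻¹] t E ∧
      Col (plat o₁ o₂ β) [] t E ∧ Col caps t [] E' := by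
  obtain ⟨t, E, E', h1, h2, hE⟩ := col_append.1 h
  obtain ⟨g, h, hg, hh, h3, h4⟩ := h1.exists_of_plat
  refine ⟨g, h, t, E, E', hg, hh, fun hgh => ?_, h3, h1, h2⟩
  have h5 : signs t = signs [g, g⁻¹, h, h⁻¹] := h3.signs_top_eq
  rw [h2.caps_eq, h5, h4] at hE
  have h6 : -Equiv.Perm.sign g ∈ (Set.univ : Set ℤˣ) := trivial
  rw [hE] at h6
  simp [hgh] at h6

/-- Among the plat closures of tangles in normal form, only those whose last part is trivial or a
half twist of the left pair can carry colors of both signs. -/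
theorem eq_of_mem_cosetWords {o₁ o₂ : Bool} {e : List (Bool × Bool)} {r : BraidWord}
    (hr : r ∈ Tangle.cosetWords)
    (h : Col (plat o₁ o₂ (twists 0 e ++ r) ++ caps) [] [] Set.univ) :
    r = [] ∨ r = [(0, true)] := by
  obtain ⟨g, h, t, E, E', -, -, hgh, h1, -, h2⟩ := h.exists_of_plat_caps
  rw [layers_append] at h1
  obtain ⟨m, E₁, E₂, h3, h4, -⟩ := col_append.1 h1
  have h5 := h3.map_sign_eq
  obtain ⟨x₁, x₂, x₃, x₄, rfl⟩ : ∃ x₁ x₂ x₃ x₄, m = [x₁, x₂, x₃, x₄] := by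
    have : m.length = 4 := by simpa using congrArg List.length h5
    match m, this with
    | [x₁, x₂, x₃, x₄], _ => exact ⟨x₁, x₂, x₃, x₄, rfl⟩
  simp only [List.map_cons, List.map_nil, List.cons.injEq, Equiv.Perm.sign_inv, and_true] at h5
  obtain ⟨h6, h7, h8, h9⟩ := h5
  simp only [Tangle.cosetWords, List.mem_cons, List.not_mem_nil, or_false] at hr
  rcases hr with rfl | rfl | rfl | rfl | rfl | rfl
  · exact .inl rfl
  · exact .inr rfl
  all_goals
    simp at h4
    obtain ⟨rfl, -⟩ := h4
    have h10 := h2.sign_eq_of_caps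
    simp [h6, h7, h8, mul_comm, units_mul_self_mul, hgh, hgh.symm] at h10

/-! ### Four colors -/

/-- The signed colors above a crossing of four strands at the position `j`. -/
def crossFour (j : Fin 3) (b : Bool) : List S3 → List S3
  | [x₁, x₂, x₃, x₄] =>
    match j with
    | 0 => crossColors b x₁ x₂ ++ [x₃, x₄]
    | 1 => x₁ :: (crossColors b x₂ x₃ ++ [x₄])
    | 2 => x₁ :: x₂ :: crossColors b x₃ x₄
  | _ => []

theorem cstep_cross_four {j : Fin 3} {b : Bool} {x₁ x₂ x₃ x₄ : S3} {t : List S3} :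
    CStep ⟨.cross b, j⟩ [x₁, x₂, x₃, x₄] t ↔ t = crossFour j b [x₁, x₂, x₃, x₄] := by
  fin_cases j <;> cases b <;> simp [crossFour]

/-- The signed colors above two minima that are colored by `g` and `h`. -/
def bottomColors (g h : S3) : List S3 := [g, g⁻¹, h, h⁻¹]

/-- The signed colors after a full twist of the middle strands above `bottomColors g h`. -/
def twistedColors (g h : S3) : List S3 := [g, g⁻¹ * h * g⁻¹ * h⁻¹ * g, g⁻¹ * h * g, h⁻¹]

/-- The colors of the two middle strands above two minima, before and after a full twist. -/
def middleColors (g h : S3) : List S3 := [g⁻¹, g⁻¹ * h * g⁻¹ * h⁻¹ * g, h, g⁻¹ * h * g]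

/-- The position of the pair of strands that is colored by 3-cycles, if the left pair has
a color of the sign of `g` and the right pair one of the opposite sign. -/
def cyclePos (g : S3) : Fin 3 := if Equiv.Perm.sign g = 1 then 0 else 2

set_option maxRecDepth 100000 in
/-- Full twists of the middle pair and of the pair colored by 3-cycles interchange or fix
`bottomColors g h` and `twistedColors g h`, and no other colors occur halfway. -/
theorem twist_colors : ∀ g h : S3, Equiv.Perm.sign g ≠ Equiv.Perm.sign h →
    ∀ s ∈ [bottomColors g h, twistedColors g h], ∀ j ∈ [1, cyclePos g], ∀ b : Bool,
      (∀ x ∈ crossFour j b s, x ∈ middleColors g h) ∧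
      crossFour j b (crossFour j b s) ∈ [bottomColors g h, twistedColors g h] := by
  decide

set_option maxRecDepth 100000 in
theorem twist_true : ∀ g h : S3, Equiv.Perm.sign g ≠ Equiv.Perm.sign h →
    crossFour 1 true (crossFour 1 true (bottomColors g h)) = twistedColors g h := by
  decide

set_option maxRecDepth 100000 in
theorem mem_middleColors_of_mem : ∀ g h : S3, Equiv.Perm.sign g ≠ Equiv.Perm.sign h →
    ∀ s ∈ [bottomColors g h, twistedColors g h], ∀ x ∈ s, x ∈ middleColors g h := by
  decide

set_option maxRecDepth 100000 in
theorem toSigned_mem_middleColors : ∀ g h : S3, Equiv.Perm.sign g ≠ Equiv.Perm.sign h →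
    ∀ x ∈ middleColors g h, ∀ d : Bool, toSigned d x ∈ middleColors g h := by
  decide

set_option maxRecDepth 100000 in
theorem nodup_middleColors : ∀ g h : S3, g ≠ 1 → h ≠ 1 → Equiv.Perm.sign g ≠ Equiv.Perm.sign h →
    (middleColors g h).Nodup := by
  decide

set_option maxRecDepth 100000 in
/-- Each color occurs at one of the two middle strands, whatever their directions are. -/
theorem exists_toSigned_eq : ∀ g h : S3, Equiv.Perm.sign g ≠ Equiv.Perm.sign h →
    ∀ x ∈ middleColors g h, ∀ d d' : Bool,
      x = toSigned d g⁻¹ ∨ x = toSigned d (g⁻¹ * h * g⁻¹ * h⁻¹ * g) ∨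
        x = toSigned d' h ∨ x = toSigned d' (g⁻¹ * h * g) := by
  decide

/-- The sequence `ℓ` with `s` put in front of it. -/
def consLevel (s : List S3) (ℓ : ℕ → List S3) : ℕ → List S3
  | 0 => s
  | k + 1 => ℓ k

theorem IsLeveling.cons {P : Layer} {w : List Layer} {ℓ : ℕ → List S3} (h : IsLeveling w ℓ)
    {s : List S3} (hs : CStep P s (ℓ 0)) :
    IsLeveling (P :: w) (consLevel s ℓ) := by
  rintro (_ | k) Q hQ
  · obtain rfl : P = Q := by simpa using hQ
    exact hs
  · exact h k Q (by simpa using hQ)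

/-- The plat closure of full twists, where only 3-cycles occur on the pair of strands
that is twisted outside of the middle, uses no other colors than those of `middleColors`. -/
theorem exists_leveling_twists {g h : S3} (hgh : Equiv.Perm.sign g ≠ Equiv.Perm.sign h)
    {e : List (Bool × Bool)} {s : List S3} (hs : s ∈ [bottomColors g h, twistedColors g h])
    {E : Set ℤˣ} (hE : Col ((twists (cyclePos g) e).layers ++ caps) s [] E) :
    ∃ ℓ : ℕ → List S3, ℓ 0 = s ∧ IsLeveling ((twists (cyclePos g) e).layers ++ caps) ℓ ∧
      ∀ k, ∀ x ∈ ℓ k, x ∈ middleColors g h := by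
  have h0 := mem_middleColors_of_mem g h hgh s hs
  induction e generalizing s E with
  | nil =>
    obtain ⟨m, _, h1, ⟨_, _, h2, ⟨rfl, -⟩, -⟩, -⟩ := hE
    obtain ⟨y, rfl⟩ := cstep_cap_zero.1 h2
    refine ⟨consLevel s (consLevel [y, y⁻¹] fun _ => []), rfl, ?_, ?_⟩
    · refine IsLeveling.cons (IsLeveling.cons ?_ h2) h1
      intro k P hP
      simp at hP
    · obtain ⟨x, rfl⟩ := cstep_cap_zero.1 h1
      rintro (_ | _ | k) z hz
      · exact h0 z hz
      · change z ∈ [y, y⁻¹] at hz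
        exact h0 z (by simp at hz ⊢; tauto)
      · exact absurd hz List.not_mem_nil
  | cons p e ih =>
    rw [twists_cons, layers_cons, layers_cons, List.cons_append, List.cons_append] at hE ⊢
    obtain ⟨m, _, h1, ⟨m', E', h2, hE, -⟩, -⟩ := hE
    set j : Fin 3 := if p.1 then 1 else cyclePos g with hj
    have hj' : j ∈ [1, cyclePos g] := by rw [hj]; split_ifs <;> simp
    obtain ⟨t1, t2⟩ := twist_colors g h hgh s hs j hj' p.2
    have hm : m = crossFour j p.2 s := by
      simp only [List.mem_cons, List.not_mem_nil, or_false] at hs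
      rcases hs with rfl | rfl <;> exact cstep_cross_four.1 h1
    have hm' : m' = crossFour j p.2 m := by
      obtain ⟨x₁, x₂, x₃, x₄, rfl⟩ : ∃ x₁ x₂ x₃ x₄, m = [x₁, x₂, x₃, x₄] := by
        have hl : s.length = 4 := by
          simp only [List.mem_cons, List.not_mem_nil, or_false] at hs
          rcases hs with rfl | rfl <;> rfl
        have := length_of_cstep h1
        simp only [Kind.inputs, Kind.outputs, hl] at this
        match m, this with
        | [x₁, x₂, x₃, x₄], _ => exact ⟨x₁, x₂, x₃, x₄, rfl⟩
      exact cstep_cross_four.1 h2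
    rw [← hm, ← hm'] at t2
    rw [← hm] at t1
    obtain ⟨ℓ, rfl, l1, l2⟩ := ih t2 hE (mem_middleColors_of_mem g h hgh _ t2)
    refine ⟨consLevel s (consLevel m ℓ), rfl,
      IsLeveling.cons (IsLeveling.cons l1 h2) h1, ?_⟩
    rintro (_ | _ | k) z hz
    · exact h0 z hz
    · exact t1 z hz
    · exact l2 k z hz

/-- The full twist of the middle strands and its inverse, which bring in all four colors. -/
def padded (e : List (Bool × Bool)) : List (Bool × Bool) := (true, true) :: (true, false) :: e

/-- A full twist of the middle strands and its inverse on the bottom make all four colors occur. -/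
theorem hasColoring_four {o₁ o₂ : Bool} {g h : S3} (hg : g ≠ 1) (hh : h ≠ 1)
    (hgh : Equiv.Perm.sign g ≠ Equiv.Perm.sign h) {e : List (Bool × Bool)} {E : Set ℤˣ}
    (hE : Col ((twists (cyclePos g) (padded e)).layers ++ caps) (bottomColors g h) [] E)
    (hw : run (plat o₁ o₂ (twists (cyclePos g) (padded e)) ++ caps) [] = some []) :
    Diagram.HasColoring ⟨_, hw⟩ 4 := by
  set D : Diagram := ⟨_, hw⟩ with hD
  rw [padded, twists_cons, layers_cons, layers_cons, List.cons_append, List.cons_append] at hE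
  obtain ⟨m, _, h1, ⟨m', E', h2, hE, -⟩, -⟩ := hE
  have hm : m = crossFour 1 true (bottomColors g h) := cstep_cross_four.1 h1
  have hm' : m' = twistedColors g h := by
    rw [← twist_true g h hgh, ← hm]
    have : ∃ x₁ x₂ x₃ x₄, m = [x₁, x₂, x₃, x₄] := ⟨_, _, _, _, hm⟩
    obtain ⟨x₁, x₂, x₃, x₄, rfl⟩ := this
    exact cstep_cross_four.1 h2
  obtain ⟨ℓ', rfl, l1, l2⟩ := exists_leveling_twists hgh (s := m') (by simp [hm']) hE
  have l3 := IsLeveling.cons (IsLeveling.cons (IsLeveling.cons (IsLeveling.cons l1 h2) h1)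
    (P := ⟨.cup o₂, 0⟩) (s := [h, h⁻¹]) (cstep_cup_zero.2 ⟨g, hg, rfl⟩))
    (P := ⟨.cup o₁, 0⟩) (s := []) (cstep_cup_zero.2 ⟨h, hh, rfl⟩)
  obtain ⟨Γ, hΓ, hΓ'⟩ := Diagram.exists_coloring_of_isLeveling (D := D) l3 rfl
  refine ⟨Γ, hΓ, ?_⟩
  have hmem : ∀ k, ∀ x ∈ consLevel [] (consLevel [h, h⁻¹]
      (consLevel (bottomColors g h) (consLevel m ℓ'))) k, x ∈ middleColors g h := by
    have hb := mem_middleColors_of_mem g h hgh (bottomColors g h) (by simp)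
    rintro (_ | _ | _ | _ | k) x hx
    · exact absurd hx List.not_mem_nil
    · change x ∈ [h, h⁻¹] at hx
      exact hb x (by simp [bottomColors] at hx ⊢; tauto)
    · exact hb x hx
    · exact (twist_colors g h hgh (bottomColors g h) (by simp) 1 (by simp) true).1 x (hm ▸ hx)
    · exact l2 k x hx
  -- The directions of the middle strands agree on the second and on the fourth line.
  have d2 : D.level 2 = [o₂, !o₂, o₁, !o₁] := by
    simp [hD, Diagram.level, plat]
  have d4 : D.level 4 = [o₂, !o₂, o₁, !o₁] := by
    simp [hD, Diagram.level, plat, padded, twists_cons, step_succ_cons]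
  have key : Subtype.val '' Set.range Γ = {x | x ∈ middleColors g h} := by
    ext x
    constructor
    · rintro ⟨_, ⟨y, rfl⟩, rfl⟩
      induction y using Quot.ind with | mk p =>
      have := hmem _ _ (List.mem_of_getElem? (hΓ' p))
      have := toSigned_mem_middleColors g h hgh _ this (D.direction p)
      rwa [toSigned_toSigned] at this
    · intro hx
      have cov : ∀ (k i : ℕ) (d : Bool) (y : S3), (D.level k)[i]? = some d →
          (consLevel [] (consLevel [h, h⁻¹] (consLevel (bottomColors g h)
            (consLevel m ℓ'))) k)[i]? = some y →
          toSigned d y ∈ Subtype.val '' Set.range Γ := by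
        intro k i d y h3 h4
        have hp : i < (D.level k).length := (List.getElem?_eq_some_iff.1 h3).1
        have h5 := hΓ' ⟨(k, i), hp⟩
        have h6 := Diagram.getElem?_level (⟨(k, i), hp⟩ : D.Point)
        simp only at h5 h6
        rw [h3] at h6
        rw [h4] at h5
        rw [Option.some.inj h5, Option.some.inj h6, toSigned_toSigned]
        exact ⟨_, ⟨_, rfl⟩, rfl⟩
      rcases exists_toSigned_eq g h hgh x hx (!o₂) o₁ with rfl | rfl | rfl | rfl
      · exact cov 2 1 _ _ (by rw [d2]; rfl) rfl
      · exact cov 4 1 _ _ (by rw [d4]; rfl)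
          (by rw [consLevel, consLevel, consLevel, consLevel, hm']; rfl)
      · exact cov 2 2 _ _ (by rw [d2]; rfl) rfl
      · exact cov 4 2 _ _ (by rw [d4]; rfl)
          (by rw [consLevel, consLevel, consLevel, consLevel, hm']; rfl)
  rw [← Set.ncard_image_of_injective _ Subtype.val_injective, key]
  have : {x | x ∈ middleColors g h} = ((middleColors g h).toFinset : Set S3) := by ext; simp
  rw [this, Set.ncard_coe_finset, List.toFinset_card_of_nodup (nodup_middleColors g h hg hh hgh)]
  rfl

theorem Tangle.mk_twists_padded (i : Fin 3) (e : List (Bool × Bool)) :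
    Tangle.mk (twists i (padded e)) = Tangle.mk (twists i e) := by
  have h1 : Tangle.mk [(1, true), (1, true), (1, false), (1, false)] = Tangle.mk [] := by
    have h2 := Tangle.mk_append_cancel [] 1 true
    have h3 := Tangle.mk_append_congr (Tangle.mk_append_cancel [(1, true)] 1 true) [(1, false)]
    exact h3.trans h2
  simpa [padded, twists_cons] using Tangle.mk_append_congr h1 (twists i e)

/-- A plat closure of full twists that carries colors of both signs has a coloring by four colors.
If the left pair of strands is colored by transpositions, then all twists of the left pair are moved
to the right pair first. -/
theorem isColorable_four_of_twists {o₁ o₂ : Bool} {e : List (Bool × Bool)}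
    (hw : run (plat o₁ o₂ (twists 0 (padded e)) ++ caps) [] = some [])
    (hc : Col (plat o₁ o₂ (twists 0 (padded e)) ++ caps) [] [] Set.univ) :
    Link.IsColorable (Quot.mk Diagram.Move ⟨_, hw⟩) 4 := by
  obtain ⟨g, h, t, E, E', hg, hh, hgh, h1, h2, h3⟩ := hc.exists_of_plat_caps
  by_cases hs : Equiv.Perm.sign g = 1
  · have h4 : cyclePos g = 0 := if_pos hs
    refine ⟨⟨plat o₁ o₂ (twists (cyclePos g) (padded e)) ++ caps, by rw [h4]; exact hw⟩, ?_,
      hasColoring_four hg hh hgh (col_append.2 ⟨t, E, E', by rw [h4]; exact h1, h3, rfl⟩) _⟩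
    simp only [h4]
    rfl
  · obtain ⟨o₁', o₂', h4⟩ :=
      Tangle.exists_iso_of_mk_eq (Tangle.mk_twists_zero_eq_two (padded e)) o₁ o₂
    obtain ⟨d, hd, -⟩ := exists_run_plat o₁ o₂ (twists 0 (padded e)) []
    obtain ⟨g', h', hg', hh', h5, -⟩ := ((h4.col_iff hd t E).1 h2).exists_of_plat
    have h6 := h5.map_sign_eq.symm.trans h1.map_sign_eq
    simp only [List.map_cons, List.map_nil, List.cons.injEq, and_true] at h6
    obtain ⟨h7, -, h8, -⟩ := h6
    have h9 : cyclePos g' = 2 := if_neg (by rwa [h7])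
    have hiso := h4.append_right caps
    have hw' : run (plat o₁' o₂' (twists (cyclePos g') (padded e)) ++ caps) [] = some [] := by
      rw [h9, ← hiso.run_eq, hw]
    refine ⟨⟨_, hw'⟩, ?_, hasColoring_four hg' hh' (by rwa [h7, h8])
      (col_append.2 ⟨t, E, E', by rw [h9]; exact h5, h3, rfl⟩) hw'⟩
    simp only [h9] at hw' ⊢
    exact (hiso.link_eq hw hw').symm

end S3Link

open S3Link in
theorem mainTheorem1 (L : S3Link.Link) (h₂ : L.IsTwoBridge) (h₅ : L.IsColorable 5) :
    L.IsColorable 4 := by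
  obtain ⟨D₅, rfl, Γ, hΓ, h5⟩ := h₅
  have hsurj : Function.Surjective Γ := by
    rw [← Set.range_eq_univ, Set.eq_univ_iff_ncard, h5, Nat.card_eq_fintype_card]
    decide
  have hcol := hΓ.col_univ hsurj
  obtain ⟨D, hD, hmax⟩ : ∃ D : Diagram, D.IsDiagramOf (Quot.mk _ D₅) ∧ D.maxima = 2 := by
    have h := h₂
    unfold Link.IsTwoBridge Link.bridgeNumber at h
    have hne : {n | ∃ D : Diagram, D.IsDiagramOf (Quot.mk _ D₅) ∧ D.maxima = n}.Nonempty :=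
      Nat.nonempty_of_sInf_eq_succ h
    have := Nat.sInf_mem hne
    rwa [h] at this
  obtain ⟨o₁, o₂, β, hw, h1⟩ := D.exists_plat hmax
  obtain ⟨e, r, hr, h2⟩ := Tangle.exists_normalForm (Tangle.mk β)
  rw [← Tangle.mk_append_congr (Tangle.mk_twists_padded 0 e) r] at h2
  obtain ⟨o₁', o₂', h3⟩ := Tangle.exists_iso_of_mk_eq h2 o₁ o₂
  have h4 := h3.append_right caps
  have hw' := (h4.run_eq []).symm.trans hw
  have h5 : Quot.mk Diagram.Move D₅ = Quot.mk Diagram.Move ⟨_, hw'⟩ :=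
    (hD.symm.trans h1.symm).trans (h4.link_eq hw hw')
  have hcol' := (Diagram.col_iff_of_link_eq h5 _).1 hcol
  obtain ⟨hw'', h6⟩ : ∃ hw'' : run (plat o₁' o₂' (BraidWord.twists 0 (padded e)) ++ caps) [] =
      some [], Quot.mk Diagram.Move D₅ = Quot.mk Diagram.Move ⟨_, hw''⟩ := by
    rcases eq_of_mem_cosetWords hr hcol' with rfl | rfl
    · simp only [List.append_nil] at hw' h5
      exact ⟨hw', h5⟩
    · -- The last half twist is undone at the left maximum.
      have h7 : Iso (plat o₁' o₂' (BraidWord.twists 0 (padded e) ++ [(0, true)]) ++ caps)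
          (plat o₁' o₂' (BraidWord.twists 0 (padded e)) ++ caps) := by
        have := ((Iso.reidemeisterOneCap true 0).append_right [⟨.cap, 0⟩]).append_left
          (plat o₁' o₂' (BraidWord.twists 0 (padded e)))
        simpa [plat_append, caps] using this
      have hw'' := (h7.run_eq []).symm.trans hw'
      exact ⟨hw'', h5.trans (h7.link_eq hw' hw'')⟩
  rw [h6]
  exact isColorable_four_of_twists hw'' ((Diagram.col_iff_of_link_eq h6 _).1 hcol)
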